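/- Let $(\Omega,\mathcal F_\infty,(\mathcal F_t)_{t\in\mathbb R_+},P)$ be a filtered probability space whose filtration is right continuous and complete, with $\mathcal F_0$ generated by the $P$-null sets of $\mathcal F_\infty$. Stopping times take values in $[0,\infty]$; for a stopping time $\tau$ let $\mathcal F_\tau=\{A\in\mathcal F_\infty:\ A\cap\{\tau\le t\}\in\mathcal F_t\ \forall t\in\mathbb R_+\}$ and $L^\infty(\mathcal F_\tau)=L^\infty(\Omega,\mathcal F_\tau,P)$; inequalities and equalities in $L^\infty$ are $P$-almost sure. A *dynamic pricing procedure* is a family of maps $\Pi_{\sigma,\tau}:L^\infty(\mathcal F_\tau)\to L^\infty(\mathcal F_\sigma)$, indexed by stopping times $0\le\sigma\le\tau$, which are monotone ($X\le Y\Rightarrow\Pi_{\sigma,\tau}(X)\le\Pi_{\sigma,\tau}(Y)$), translation invariant ($\Pi_{\sigma,\tau}(X+Z)=\Pi_{\sigma,\tau}(X)+Z$ for $Z\in L^\infty(\mathcal F_\sigma)$), convex ($\Pi_{\sigma,\tau}(\lambda X+(1-\lambda)Y)\le\lambda\Pi_{\sigma,\tau}(X)+(1-\lambda)\Pi_{\sigma,\tau}(Y)$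 for $\lambda\in[0,1]$) and normalized ($\Pi_{\sigma,\tau}(0)=0$). It is a *TCPP* if it is time consistent ($\Pi_{\nu,\sigma}(\Pi_{\sigma,\tau}(X))=\Pi_{\nu,\tau}(X)$ for all $\nu\le\sigma\le\tau$ and $X\in L^\infty(\mathcal F_\tau)$) and continuous from below (if $X_n\uparrow X$ almost surely, with $X_n,X\in L^\infty(\mathcal F_\tau)$, then $\Pi_{\sigma,\tau}(X_n)\to\Pi_{\sigma,\tau}(X)$ almost surely). It has *No Free Lunch* if $\overline{\mathcal C}\cap L^\infty_+(\mathcal F_\infty)=\{0\}$, where $\overline{\mathcal C}$ is the closure of $\mathcal C=\{\lambda X:\ \lambda\ge 0,\ X\in L^\infty(\mathcal F_\infty),\ \Pi_{0,\infty}(X)\le 0\}$ for the weak* topology $\sigma(L^\infty(P),L^1(P))$. Let $(S^k)_{0\le k\le d}$ be real-valued adapted locally bounded processes indexed by $\mathbb R_+$, with $S^0\equiv1$ (locally bounded: there are stopping times $\tau_n$ increasing to $\infty$ such that each stopped process $S^k_{\cdot\wedge\tau_n}$ is uniformly bounded). For $1\le l\le p$ let $Y^l\in L^\infty(\mathcal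 F_{\tau_l})$, where $\tau_l$ is a stopping time, and let $C^l_{bid},C^l_{ask}\in\mathbb R$. A dynamic pricing procedure is *strongly admissible* with respect to these data if * for all $0\le k\le d$, all $n\in\mathbb Z$ and all stopping times $\sigma\le\tau$, with $\tau$ almost surely finite, such that $S^k_\tau\in L^\infty(\mathcal F_\tau)$, one has $\Pi_{\sigma,\tau}(nS^k_\tau)=nS^k_\sigma$; * for all $1\le l\le p$, $C^l_{bid}\le-\Pi_{0,\tau_l}(-Y^l)\le\Pi_{0,\tau_l}(Y^l)\le C^l_{ask}$. Let $\mathcal M^e$ be the set of equivalent local martingale measures, that is, of the probability measures $Q$ on $\mathcal F_\infty$ with $Q\sim P$ such that $E_Q(S^k_\tau|\mathcal F_\sigma)=S^k_\sigma$ $Q$-a.s. for all $0\le k\le d$ and all stopping times $\sigma\le\tau$, with $\tau$ almost surely finite, such that $S^k_\tau\in L^\infty(\mathcal F_\tau)$. For $Q\in\mathcal M^e$ put $$\beta(Q)=\sup\Bigl(0,\ \sup_{1\le l\le p}\max\bigl(C^l_{bid}-E_Q(Y^l),\ E_Q(Y^l)-C^l_{ask}\bigr)\Bigr).$$ **Proposition.**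 For every TCPP that has No Free Lunch and is strongly admissible with respect to $((S^k)_{0\le k\le d},(Y^l)_{1\le l\le p})$ and $(C^l_{bid},C^l_{ask})_{1\le l\le p}$, and for every $X\in L^\infty(\mathcal F_\infty)$, $$\inf_{Q\in\mathcal M^e}\bigl(E_Q(X)+\beta(Q)\bigr)\le-\Pi_{0,\infty}(-X)\le\Pi_{0,\infty}(X)\le\sup_{Q\in\mathcal M^e}\bigl(E_Q(X)-\beta(Q)\bigr),$$ where the infimum and the supremum are taken in $[-\infty,\infty]$ (so that the inequalities include $\mathcal M^e\ne\emptyset$), and where $\Pi_{0,\infty}(\pm X)$, being measurable with respect to the trivial $\mathcal F_0$, are identified with constants. -/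

import Mathlib

open MeasureTheory ProbabilityTheory Filter Topology
open scoped NNReal ENNReal

noncomputable section

namespace BidAsk

variable {Ω : Type*} [mΩ : MeasurableSpace Ω]

/-- Standing assumptions on the filtered probability space. The ambient σ-algebra `mΩ` plays the
role of `F_∞`; the filtration is right continuous and complete, and `F_0` is generated by the
null sets of `F_∞`. -/
structure UsualConditions (P : Measure Ω) (𝓕 : Filtration ℝ≥0 mΩ) : Prop where
  rightCont : 𝓕.IsRightContinuous
  complete : P.IsComplete
  zero_eq : 𝓕 0 = MeasurableSpace.generateFrom {s | MeasurableSet s ∧ P s = 0}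

/-- Stopping times with values in `[0, ∞]`, with the pointwise order. -/
abbrev StopTime (𝓕 : Filtration ℝ≥0 mΩ) : Type _ :=
  {τ : Ω → WithTop ℝ≥0 // IsStoppingTime 𝓕 τ}

namespace StopTime

variable {𝓕 : Filtration ℝ≥0 mΩ}

/-- The stopping time `0`. -/
def zero (𝓕 : Filtration ℝ≥0 mΩ) : StopTime 𝓕 :=
  ⟨fun _ => ((0 : ℝ≥0) : WithTop ℝ≥0), isStoppingTime_const 𝓕 0⟩

/-- The stopping time `∞`. -/
def infty (𝓕 : Filtration ℝ≥0 mΩ) : StopTime 𝓕 :=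
  ⟨fun _ => ⊤, fun i => by simp⟩

theorem zero_le (τ : StopTime 𝓕) : zero 𝓕 ≤ τ := fun ω => by
  change ((0 : ℝ≥0) : WithTop ℝ≥0) ≤ τ.1 ω
  exact _root_.zero_le

theorem le_infty (τ : StopTime 𝓕) : τ ≤ infty 𝓕 := fun _ => le_top

/-- `F_τ = {A ∈ F_∞ | ∀ t, A ∩ {τ ≤ t} ∈ F_t}`. (Mathlib's version asks for
`A ∈ σ(⋃ F_t)` instead; here `F_∞` is the ambient σ-algebra, which may be larger.) -/
@[reducible] def sigmaAlg (τ : StopTime 𝓕) : MeasurableSpace Ω where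
  MeasurableSet' s := MeasurableSet[mΩ] s ∧ ∀ t : ℝ≥0, MeasurableSet[𝓕 t] (s ∩ {ω | τ.1 ω ≤ t})
  measurableSet_empty := ⟨MeasurableSet.empty, fun t => by simp⟩
  measurableSet_compl s hs := by
    refine ⟨hs.1.compl, fun t => ?_⟩
    have h : sᶜ ∩ {ω | τ.1 ω ≤ t} = {ω | τ.1 ω ≤ t} \ (s ∩ {ω | τ.1 ω ≤ t}) := by
      ext ω; simp only [Set.mem_inter_iff, Set.mem_compl_iff, Set.mem_sdiff]; tauto
    rw [h]
    exact (τ.2 t).diff (hs.2 t)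
  measurableSet_iUnion f hf := by
    refine ⟨MeasurableSet.iUnion fun i => (hf i).1, fun t => ?_⟩
    rw [Set.iUnion_inter]
    exact MeasurableSet.iUnion fun i => (hf i).2 t

theorem sigmaAlg_mono {σ τ : StopTime 𝓕} (h : σ ≤ τ) : σ.sigmaAlg ≤ τ.sigmaAlg := by
  intro s hs
  refine ⟨hs.1, fun t => ?_⟩
  have h' : s ∩ {ω | τ.1 ω ≤ t} = (s ∩ {ω | σ.1 ω ≤ t}) ∩ {ω | τ.1 ω ≤ t} := by
    ext ω
    simp only [Set.mem_inter_iff]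
    exact ⟨fun ⟨h1, h2⟩ => ⟨⟨h1, (h ω).trans h2⟩, h2⟩, fun ⟨⟨h1, _⟩, h2⟩ => ⟨h1, h2⟩⟩
  rw [h']
  exact (hs.2 t).inter (τ.2 t)

theorem sigmaAlg_infty : (infty 𝓕).sigmaAlg = mΩ := by
  refine le_antisymm (fun s hs => hs.1) (fun s hs => ⟨hs, fun t => ?_⟩)
  have h : s ∩ {ω | (infty 𝓕).1 ω ≤ t} = ∅ :=
    Set.eq_empty_iff_forall_notMem.2 fun ω hω => not_le.2 (WithTop.coe_lt_top t) hω.2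
  rw [h]
  exact @MeasurableSet.empty Ω (𝓕 t)

theorem sigmaAlg_zero : (zero 𝓕).sigmaAlg = 𝓕 0 := by
  refine le_antisymm (fun s hs => ?_) (fun s hs => ⟨𝓕.le 0 s hs, fun t => ?_⟩)
  · simpa [zero] using hs.2 0
  · have h : s ∩ {ω | (zero 𝓕).1 ω ≤ t} = s :=
      Set.inter_eq_left.2 fun ω _ => WithTop.coe_le_coe.2 (_root_.zero_le (a := t))
    rw [h]
    exact 𝓕.mono (_root_.zero_le (a := t)) s hs

end StopTime

variable {P : Measure Ω} {𝓕 : Filtration ℝ≥0 mΩ}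

/-- `L^∞(Ω, F_τ, P)`: the classes in `L^∞(Ω, F_∞, P)` that have an `F_τ`-measurable
representative. The order inherited from `L^∞` is the almost sure order. -/
abbrev LInf (P : Measure Ω) (τ : StopTime 𝓕) : Submodule ℝ (Lp ℝ ∞ P) :=
  lpMeas ℝ ℝ τ.sigmaAlg ∞ P

/-- The inclusion `L^∞(F_σ) ⊆ L^∞(F_τ)` for `σ ≤ τ`. -/
def LInf.incl {σ τ : StopTime 𝓕} (h : σ ≤ τ) (Z : LInf P σ) : LInf P τ :=
  ⟨(Z : Lp ℝ ∞ P), AEStronglyMeasurable.mono (StopTime.sigmaAlg_mono h) Z.2⟩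

/-- A dynamic pricing procedure: maps `Π_{σ,τ} : L^∞(F_τ) → L^∞(F_σ)`, `σ ≤ τ`, that are monotone,
translation invariant, convex and normalized. -/
structure PricingProcedure (P : Measure Ω) (𝓕 : Filtration ℝ≥0 mΩ) where
  /-- the ask price `Π_{σ,τ}` -/
  ask : ∀ {σ τ : StopTime 𝓕}, σ ≤ τ → LInf P τ → LInf P σ
  monotone : ∀ {σ τ : StopTime 𝓕} (h : σ ≤ τ) (X Y : LInf P τ), X ≤ Y → ask h X ≤ ask h Y
  translation : ∀ {σ τ : StopTime 𝓕} (h : σ ≤ τ) (Z : LInf P σ) (X : LInf P τ),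
    ask h (X + LInf.incl h Z) = ask h X + Z
  convex : ∀ {σ τ : StopTime 𝓕} (h : σ ≤ τ) (X Y : LInf P τ) (c : ℝ), 0 ≤ c → c ≤ 1 →
    ask h (c • X + (1 - c) • Y) ≤ c • ask h X + (1 - c) • ask h Y
  normalized : ∀ {σ τ : StopTime 𝓕} (h : σ ≤ τ), ask h 0 = 0

namespace PricingProcedure

/-- The bid price `-Π_{σ,τ}(-X)`. -/
def bid (Pi : PricingProcedure P 𝓕) {σ τ : StopTime 𝓕} (h : σ ≤ τ) (X : LInf P τ) : LInf P σ :=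
  -Pi.ask h (-X)

def TimeConsistent (Pi : PricingProcedure P 𝓕) : Prop :=
  ∀ (ν σ τ : StopTime 𝓕) (h₁ : ν ≤ σ) (h₂ : σ ≤ τ) (X : LInf P τ),
    Pi.ask h₁ (Pi.ask h₂ X) = Pi.ask (h₁.trans h₂) X

/-- If `X_n` increases almost surely to `X` in `L^∞(F_τ)`, then `Π_{σ,τ}(X_n)` converges almost
surely to `Π_{σ,τ}(X)`. -/
def ContinuousFromBelow (Pi : PricingProcedure P 𝓕) : Prop :=
  ∀ (σ τ : StopTime 𝓕) (h : σ ≤ τ) (Xn : ℕ → LInf P τ) (X : LInf P τ), Monotone Xn →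
    (∀ᵐ ω ∂P, Tendsto (fun n => (Xn n : Lp ℝ ∞ P) ω) atTop (𝓝 ((X : Lp ℝ ∞ P) ω))) →
    ∀ᵐ ω ∂P, Tendsto (fun n => (Pi.ask h (Xn n) : Lp ℝ ∞ P) ω) atTop
      (𝓝 ((Pi.ask h X : Lp ℝ ∞ P) ω))

/-- A TCPP is a time-consistent dynamic pricing procedure continuous from below. -/
structure IsTCPP (Pi : PricingProcedure P 𝓕) : Prop where
  timeConsistent : Pi.TimeConsistent
  continuousFromBelow : Pi.ContinuousFromBelow

/-- The cone `C = {c X | c ≥ 0, X ∈ L^∞(F_∞), Π_{0,∞}(X) ≤ 0}`. -/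
def zeroCostCone (Pi : PricingProcedure P 𝓕) : Set (Lp ℝ ∞ P) :=
  {W | ∃ (c : ℝ) (X : LInf P (StopTime.infty 𝓕)), 0 ≤ c ∧
    Pi.ask (StopTime.zero_le _) X ≤ 0 ∧ W = c • (X : Lp ℝ ∞ P)}

end PricingProcedure

/-- The weak* topology `σ(L^∞(P), L^1(P))`: the coarsest topology for which
`X ↦ E_P(X g)` is continuous for every `g ∈ L^1(P)`. -/
@[reducible] def weakStar (P : Measure Ω) : TopologicalSpace (Lp ℝ ∞ P) :=
  TopologicalSpace.induced
    (fun (X : Lp ℝ ∞ P) (g : Lp ℝ 1 P) => ∫ ω, X ω * g ω ∂P) inferInstance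

namespace PricingProcedure

/-- No (static) free lunch: the weak* closure of the cone `C` meets `L^∞_+` only in `0`. -/
def NoFreeLunch (Pi : PricingProcedure P 𝓕) : Prop :=
  @closure _ (weakStar P) Pi.zeroCostCone ∩ {W | 0 ≤ W} = {0}

/-- The procedure extends the dynamics of the price processes `S^k`: for all `k`, all `n ∈ ℤ` and
all stopping times `σ ≤ τ`, with `τ` almost surely finite (so that `S^k_τ` is defined), such
that `S^k_τ ∈ L^∞(F_τ)`, one has `Π_{σ,τ}(n S^k_τ) = n S^k_σ`. -/
def ExtendsDynamics {ι : Type*} (Pi : PricingProcedure P 𝓕) (S : ι → ℝ≥0 → Ω → ℝ) : Prop :=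
  ∀ (k : ι) (n : ℤ) (σ τ : StopTime 𝓕) (h : σ ≤ τ), (∀ᵐ ω ∂P, τ.1 ω ≠ ⊤) →
    ∀ V : LInf P τ, (V : Lp ℝ ∞ P) =ᵐ[P] stoppedValue (S k) τ.1 →
      (Pi.ask h ((n : ℝ) • V) : Lp ℝ ∞ P) =ᵐ[P] fun ω => (n : ℝ) * stoppedValue (S k) σ.1 ω

/-- Strong admissibility with respect to the basic assets `S`, the options `Y l` of maturity `T l`,
and their observed bid and ask prices at time `0`. -/
structure StronglyAdmissible {ι κ : Type*} (Pi : PricingProcedure P 𝓕) (S : ι → ℝ≥0 → Ω → ℝ)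
    (T : κ → StopTime 𝓕) (Y : ∀ l, LInf P (T l)) (Cbid Cask : κ → ℝ) : Prop where
  extendsDynamics : Pi.ExtendsDynamics S
  compatible : ∀ l, ∀ᵐ ω ∂P,
    Cbid l ≤ (Pi.bid (StopTime.zero_le (T l)) (Y l) : Lp ℝ ∞ P) ω ∧
    (Pi.bid (StopTime.zero_le (T l)) (Y l) : Lp ℝ ∞ P) ω ≤
      (Pi.ask (StopTime.zero_le (T l)) (Y l) : Lp ℝ ∞ P) ω ∧
    (Pi.ask (StopTime.zero_le (T l)) (Y l) : Lp ℝ ∞ P) ω ≤ Cask l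

end PricingProcedure

/-- There is a sequence of stopping times increasing to `∞` such that each stopped process is
uniformly bounded. -/
def LocallyBounded (P : Measure Ω) (𝓕 : Filtration ℝ≥0 mΩ) (S : ℝ≥0 → Ω → ℝ) : Prop :=
  ∃ τ : ℕ → Ω → WithTop ℝ≥0, IsLocalizingSequence 𝓕 τ P ∧
    ∀ n, ∃ C : ℝ, ∀ᵐ ω ∂P, ∀ t, |stoppedValue S (fun ω => min (t : WithTop ℝ≥0) (τ n ω)) ω| ≤ C

/-- The set `M^e` of equivalent local martingale measures for the processes `S^k`: probability
measures `Q ∼ P` with `E_Q(S^k_τ | F_σ) = S^k_σ` for all `k` and all stopping times `σ ≤ τ`, with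
`τ` almost surely finite, such that `S^k_τ ∈ L^∞(F_τ)`. -/
def EquivLocalMartingaleMeasures {ι : Type*} (P : Measure Ω) (𝓕 : Filtration ℝ≥0 mΩ)
    (S : ι → ℝ≥0 → Ω → ℝ) : Set (Measure Ω) :=
  {Q | IsProbabilityMeasure Q ∧ Q ≪ P ∧ P ≪ Q ∧
    ∀ (k : ι) (σ τ : StopTime 𝓕), σ ≤ τ → (∀ᵐ ω ∂P, τ.1 ω ≠ ⊤) →
      ∀ V : LInf P τ, (V : Lp ℝ ∞ P) =ᵐ[P] stoppedValue (S k) τ.1 →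
        Q[((V : Lp ℝ ∞ P) : Ω → ℝ) | σ.sigmaAlg] =ᵐ[Q] stoppedValue (S k) σ.1}

/-- `β(Q) = sup(0, sup_l max(C^l_bid - E_Q(Y^l), E_Q(Y^l) - C^l_ask))`, for a finite family. -/
def beta {p : ℕ} {T : Fin p → StopTime 𝓕} (Y : ∀ l, LInf P (T l)) (Cbid Cask : Fin p → ℝ)
    (Q : Measure Ω) : ℝ :=
  max 0 (⨆ l : Fin p, max (Cbid l - ∫ ω, (Y l : Lp ℝ ∞ P) ω ∂Q)
    ((∫ ω, (Y l : Lp ℝ ∞ P) ω ∂Q) - Cask l))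

end BidAsk

end

namespace BidAsk

/-! ### Weak compactness and a minimax lemma in Hilbert spaces -/

section Hilbert

variable {H : Type*} [NormedAddCommGroup H] [InnerProductSpace ℝ H] [CompleteSpace H]

/-! Time consistency and the triviality of F_0 reduce all time-zero prices to one real functional Φ
= `askZero` on L^∞, which is monotone, cash-additive, convex and continuous from below. Write α(Q) =
sup_Y (E_Q(Y) - Φ(Y)) for the penalty of a probability Q.

Any Q ∼ P of finite penalty is admissible in the supremum. If V = S_τ and U = Π_{σ,τ}(V) = S_σ, then
for A ∈ F_σ the payoff n(V - U)1_A costs at most 0 at time zero, so n E_Q((V - U)1_A) ≤ α(Q) for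
every integer n. This forces the expectation to vanish, and Q is a local martingale measure. Testing
the penalty on Y^l and -Y^l, whose prices are controlled by the quotes, gives β(Q) ≤ α(Q).

It remains to find, for each t < Φ(X), some Q ∼ P with t < E_Q(X) - α(Q). An approximate subgradient
of Φ at X is the density of a probability that may fail to be equivalent to P. Mixing in a little of
an R ∼ P with E_R ≤ Φ repairs this at small cost. No Free Lunch supplies R by the Kreps-Yan
argument: Hahn-Banach in σ(L^∞, L^1), then exhaustion.

The subgradient must lie in L^1 and not merely in the dual of L^∞; continuity from below ensures
this. Balls of L^∞ are convex and weakly compact in L^2, and Φ is lower semicontinuous there. Sion's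
minimax theorem therefore replaces a multiplier depending on the test variable by a uniform one.
Doubling the radius of the ball repeatedly costs L^1 perturbations that decrease geometrically, so
the multipliers converge in L^1. The bid inequality is the ask inequality for -X. -/

theorem isCompact_toWeakSpace_closedBall (R : ℝ) :
    IsCompact (toWeakSpace ℝ H '' Metric.closedBall 0 R) := by
  have hG : Continuous fun x' : WeakDual ℝ H =>
      toWeakSpace ℝ H ((InnerProductSpace.toDual ℝ H).symm (WeakDual.toStrongDual x')) := by
    refine WeakBilin.continuous_of_continuous_eval _ fun y => ?_
    have h : ∀ x' : WeakDual ℝ H,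
        y ((InnerProductSpace.toDual ℝ H).symm (WeakDual.toStrongDual x')) =
          x' ((InnerProductSpace.toDual ℝ H).symm y) := fun x' => by
      rw [← InnerProductSpace.toDual_symm_apply (y := y), real_inner_comm,
        InnerProductSpace.toDual_symm_apply]
      rfl
    exact (WeakDual.eval_continuous ((InnerProductSpace.toDual ℝ H).symm y)).congr
      fun x' => (h x').symm
  refine ((WeakDual.isCompact_closedBall (0 : StrongDual ℝ H) R).image hG).of_isClosed_subset
    ?_ ?_
  · have := (convex_closedBall (0 : H) R).toWeakSpace_closure ℝ
    rw [Metric.isClosed_closedBall.closure_eq] at this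
    rw [this]
    exact isClosed_closure
  · rintro _ ⟨x, hx, rfl⟩
    refine ⟨StrongDual.toWeakDual (InnerProductSpace.toDual ℝ H x), ?_, ?_⟩
    · simpa using hx
    · simp

/-- By Mazur's theorem norm-closed convex sets are weakly closed, so this is a closed subset of a
weakly compact ball. -/
theorem isCompact_toWeakSpace_of_convex {s : Set H} (hc : Convex ℝ s) (hcl : IsClosed s)
    (hb : Bornology.IsBounded s) : IsCompact (toWeakSpace ℝ H '' s) := by
  obtain ⟨R, hR⟩ := hb.subset_closedBall 0
  refine (isCompact_toWeakSpace_closedBall R).of_isClosed_subset ?_ (Set.image_mono hR)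
  have := hc.toWeakSpace_closure ℝ
  rw [hcl.closure_eq] at this
  rw [this]
  exact isClosed_closure

/-- If every point of a convex set `K` that is weakly compact for the pairing with `H` can be
handled by some `y` of a convex set `Y`, then one `y` handles all of `K`. -/
theorem exists_uniform_of_forall_exists {E : Type*} [AddCommGroup E] [Module ℝ E]
    (J : E →ₗ[ℝ] H) (hJ : Function.Injective J) {K : Set E} (hK : Convex ℝ K)
    (hKne : K.Nonempty) (hKb : Bornology.IsBounded (J '' K)) (hKcl : IsClosed (J '' K))
    {φ : E → ℝ} (hφ : ConvexOn ℝ K φ) (hφcl : ∀ c, IsClosed (J '' {z ∈ K | φ z ≤ c}))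
    {Y : Set H} (hY : Convex ℝ Y) {t : ℝ}
    (h : ∀ z ∈ K, ∃ y ∈ Y, t < φ z + inner ℝ y (J z)) :
    ∃ y ∈ Y, ∀ z ∈ K, t < φ z + inner ℝ y (J z) := by
  let j : E →ₗ[ℝ] WeakSpace ℝ H := (toWeakSpace ℝ H).toLinearMap.comp J
  have hj : Function.Injective j := (toWeakSpace ℝ H).injective.comp hJ
  -- `E` carries the topology pulled back from the weak topology of `H`, whatever its own norm may
  -- be. Compactness in `E` then means weak compactness of the image under `J`.
  let : TopologicalSpace E := TopologicalSpace.induced j inferInstance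
  have hind : IsInducing j := ⟨rfl⟩
  have : T2Space E := T2Space.of_injective_continuous hj hind.continuous
  have : IsTopologicalAddGroup E := topologicalAddGroup_induced j
  have : ContinuousSMul ℝ E := continuousSMul_induced j
  have key : ∀ s : Set E, s ⊆ K → Convex ℝ s → IsClosed (J '' s) → IsCompact s := by
    intro s hsK hs hcl
    rw [hind.isCompact_iff]
    have : j '' s = toWeakSpace ℝ H '' (J '' s) := by rw [Set.image_image]; rfl
    rw [this]
    exact isCompact_toWeakSpace_of_convex (hs.linear_image J) hcl
      (hKb.subset (Set.image_mono hsK))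
  have hKc : IsCompact K := key K subset_rfl hK hKcl
  have hφl : LowerSemicontinuousOn φ K := by
    rw [lowerSemicontinuousOn_iff_preimage_Iic]
    intro c
    refine ⟨{z ∈ K | φ z ≤ c}, (key _ (Set.sep_subset _ _) ?_ (hφcl c)).isClosed, ?_⟩
    · exact hφ.convex_le c
    · ext z; simp
  have hin : ∀ y : H, Continuous fun z : E => inner ℝ y (J z) := fun y =>
    (WeakBilin.eval_continuous (topDualPairing ℝ H).flip (innerSL ℝ y)).comp hind.continuous
  have hl : ∀ y ∈ Y, LowerSemicontinuousOn (fun z => φ z + inner ℝ y (J z)) K := fun y _ =>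
    hφl.add ((hin y).lowerSemicontinuous.lowerSemicontinuousOn _)
  -- Lower semicontinuity makes the strict inequality an open condition on `z`, so compactness
  -- leaves finitely many `y`; Sion's theorem merges them into one.
  have hfin : ∃ s : Set H, s.Finite ∧ s ⊆ Y ∧ ∀ z ∈ K, ∃ y ∈ s, t < φ z + inner ℝ y (J z) := by
    have hopen : ∀ y : Y, ∃ U : Set E, IsOpen U ∧
        ∀ z ∈ K, (z ∈ U ↔ t < φ z + inner ℝ (y : H) (J z)) := fun y => by
      obtain ⟨U, hU, hU'⟩ := (lowerSemicontinuousOn_iff_preimage_Ioi.1 (hl y y.2)) t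
      refine ⟨U, hU, fun z hz => ?_⟩
      have := Set.ext_iff.1 hU' z
      simp only [Set.mem_inter_iff, hz, true_and, Set.mem_preimage, Set.mem_Ioi] at this
      exact this.symm
    choose U hU hU' using hopen
    obtain ⟨F, hF⟩ := hKc.elim_finite_subcover U hU fun z hz => by
      obtain ⟨y, hy, hyt⟩ := h z hz
      exact Set.mem_iUnion.2 ⟨⟨y, hy⟩, (hU' _ z hz).2 hyt⟩
    refine ⟨(↑) '' (F : Set Y), F.finite_toSet.image _, by simp, fun z hz => ?_⟩
    obtain ⟨y, hyF, hy⟩ := Set.mem_iUnion₂.1 (hF hz)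
    exact ⟨y, ⟨y, hyF, rfl⟩, (hU' y z hz).1 hy⟩
  obtain ⟨s, hs, hsY, hst⟩ := hfin
  refine Sion.exists_lt_iInf_of_lt_iInf_of_finite hKne hKc hl (fun y _ => ?_) hY
    (fun z _ => ?_) (fun z _ => ?_) hK hs hsY hst
  · exact (hφ.add (((innerSL ℝ y).toLinearMap.comp J).convexOn hK)).quasiconvexOn
  · exact (Continuous.upperSemicontinuous (by fun_prop)).upperSemicontinuousOn _
  · refine ConcaveOn.quasiconcaveOn ((concaveOn_const _ hY).add ⟨hY, ?_⟩)
    intro x _ y _ a b _ _ _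
    simp [inner_add_left, inner_smul_left]

end Hilbert

/-! ### Bounded random variables -/

section LInfinity

variable {Ω : Type*} [mΩ : MeasurableSpace Ω] {P : Measure Ω}

/-- The inclusion `L^q ⊆ L^p`, `p ≤ q`, for a finite measure. -/
noncomputable def lpIncl [IsFiniteMeasure P] {p q : ℝ≥0∞} (h : p ≤ q) : Lp ℝ q P →ₗ[ℝ] Lp ℝ p P where
  toFun Z := ((Lp.memLp Z).mono_exponent h).toLp Z
  map_add' Z W := by
    rw [← MemLp.toLp_add]
    exact MemLp.toLp_congr _ _ (Lp.coeFn_add Z W)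
  map_smul' c Z := by
    rw [RingHom.id_apply, ← MemLp.toLp_const_smul]
    exact MemLp.toLp_congr _ _ (Lp.coeFn_smul c Z)

theorem coeFn_lpIncl [IsFiniteMeasure P] {p q : ℝ≥0∞} (h : p ≤ q) (Z : Lp ℝ q P) :
    lpIncl h Z =ᵐ[P] Z :=
  ((Lp.memLp Z).mono_exponent h).coeFn_toLp

theorem lpIncl_injective [IsFiniteMeasure P] {p q : ℝ≥0∞} (h : p ≤ q) :
    Function.Injective (lpIncl (P := P) h) := fun Z W hZW => by
  refine Lp.ext ?_
  filter_upwards [coeFn_lpIncl h Z, coeFn_lpIncl h W] with ω h1 h2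
  rw [← h1, ← h2, hZW]

theorem LInfty.ae_abs_le_norm (Z : Lp ℝ ∞ P) : ∀ᵐ ω ∂P, |Z ω| ≤ ‖Z‖ := by
  have h := ae_le_eLpNormEssSup (f := (Z : Ω → ℝ)) (μ := P)
  rw [← eLpNorm_exponent_top] at h
  filter_upwards [h] with ω hω
  rw [Lp.norm_def, ← Real.norm_eq_abs, ← toReal_enorm]
  exact ENNReal.toReal_mono (Lp.eLpNorm_ne_top Z) hω

theorem LInfty.norm_le_iff [IsProbabilityMeasure P] (Z : Lp ℝ ∞ P) {m : ℝ} (hm : 0 ≤ m) :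
    ‖Z‖ ≤ m ↔ ∀ᵐ ω ∂P, |Z ω| ≤ m := by
  refine ⟨fun h => (LInfty.ae_abs_le_norm Z).mono fun ω hω => hω.trans h, fun h => ?_⟩
  have := Lp.norm_le_of_ae_bound (f := Z) hm h
  simpa using this

theorem LInfty.integrable_mul {g : Ω → ℝ} (hg : Integrable g P) (Z : Lp ℝ ∞ P) :
    Integrable (fun ω => Z ω * g ω) P :=
  hg.bdd_mul (Lp.aestronglyMeasurable Z) (LInfty.ae_abs_le_norm Z)

/-- `L^1` as linear functionals on `L^∞`. -/
noncomputable def pairing (P : Measure Ω) : Lp ℝ ∞ P →ₗ[ℝ] Lp ℝ 1 P →ₗ[ℝ] ℝ :=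
  LinearMap.mk₂ ℝ (fun Z g => ∫ ω, Z ω * g ω ∂P)
    (fun Z W g => by
      rw [← integral_add (LInfty.integrable_mul (L1.integrable_coeFn g) Z)
        (LInfty.integrable_mul (L1.integrable_coeFn g) W)]
      refine integral_congr_ae ?_
      filter_upwards [Lp.coeFn_add Z W] with ω h
      rw [h, Pi.add_apply, add_mul])
    (fun c Z g => by
      rw [smul_eq_mul, ← integral_const_mul]
      refine integral_congr_ae ?_
      filter_upwards [Lp.coeFn_smul c Z] with ω h
      rw [h, Pi.smul_apply, smul_eq_mul, mul_assoc])
    (fun Z f g => by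
      rw [← integral_add (LInfty.integrable_mul (L1.integrable_coeFn f) Z)
        (LInfty.integrable_mul (L1.integrable_coeFn g) Z)]
      refine integral_congr_ae ?_
      filter_upwards [Lp.coeFn_add f g] with ω h
      rw [h, Pi.add_apply, mul_add])
    (fun c Z g => by
      rw [smul_eq_mul, ← integral_const_mul]
      refine integral_congr_ae ?_
      filter_upwards [Lp.coeFn_smul c g] with ω h
      rw [h, Pi.smul_apply, smul_eq_mul, mul_left_comm])

theorem pairing_apply (Z : Lp ℝ ∞ P) (g : Lp ℝ 1 P) :
    pairing P Z g = ∫ ω, Z ω * g ω ∂P := rfl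

theorem abs_pairing_le (Z : Lp ℝ ∞ P) (g : Lp ℝ 1 P) : |pairing P Z g| ≤ ‖Z‖ * ‖g‖ := by
  rw [pairing_apply, L1.norm_eq_integral_norm, ← integral_const_mul, ← Real.norm_eq_abs]
  refine norm_integral_le_of_norm_le ((L1.integrable_coeFn g).norm.const_mul _) ?_
  filter_upwards [LInfty.ae_abs_le_norm Z] with ω h
  rw [norm_mul]
  gcongr
  exact h

theorem continuous_pairing (Z : Lp ℝ ∞ P) : Continuous (pairing P Z) :=
  (LinearMap.mkContinuous (pairing P Z) ‖Z‖ (abs_pairing_le Z)).continuous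

theorem pairing_indicator [IsFiniteMeasure P] {A : Set Ω} (hA : MeasurableSet A) (c : ℝ) (g : Lp ℝ 1 P) :
    pairing P (indicatorConstLp ∞ hA (measure_ne_top P A) c) g = c * ∫ ω in A, g ω ∂P := by
  rw [pairing_apply, ← integral_const_mul, ← integral_indicator hA]
  refine integral_congr_ae ?_
  filter_upwards [indicatorConstLp_coeFn (p := ∞) (hs := hA) (hμs := measure_ne_top P A) (c := c)]
    with ω h
  rw [h]
  by_cases hω : ω ∈ A <;> simp [hω]

theorem pairing_const [IsFiniteMeasure P] (c : ℝ) (g : Lp ℝ 1 P) :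
    pairing P (Lp.const ∞ P c) g = c * ∫ ω, g ω ∂P := by
  rw [pairing_apply, ← integral_const_mul]
  refine integral_congr_ae ?_
  filter_upwards [Lp.coeFn_const (p := ∞) (μ := P) c] with ω h
  rw [h, Function.const_apply]

theorem inner_lpIncl [IsFiniteMeasure P] (y : Lp ℝ 2 P) (Z : Lp ℝ ∞ P) :
    inner ℝ y (lpIncl le_top Z) = pairing P Z (lpIncl one_le_two y) := by
  rw [L2.inner_def, pairing_apply]
  refine integral_congr_ae ?_
  filter_upwards [coeFn_lpIncl (p := 2) le_top Z, coeFn_lpIncl one_le_two y] with ω h1 h2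
  rw [h1, h2]
  simp

/-- A convex set of uniformly bounded functions that is closed under almost sure convergence is
closed in `L^2`. -/
theorem isClosed_lpIncl_image [IsProbabilityMeasure P] {s : Set (Lp ℝ ∞ P)} {m : ℝ} (hm : 0 ≤ m)
    (hs : ∀ Z ∈ s, ‖Z‖ ≤ m)
    (hcl : ∀ (Zn : ℕ → Lp ℝ ∞ P) (Z : Lp ℝ ∞ P), (∀ n, Zn n ∈ s) → ‖Z‖ ≤ m →
      (∀ᵐ ω ∂P, Tendsto (fun n => Zn n ω) atTop (𝓝 (Z ω))) → Z ∈ s) :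
    IsClosed (lpIncl (P := P) (p := 2) le_top '' s) := by
  refine isClosed_of_closure_subset fun w hw => ?_
  obtain ⟨wn, hwn, hlim⟩ := mem_closure_iff_seq_limit.1 hw
  choose Zn hZn hZw using hwn
  obtain ⟨ns, -, hns⟩ := (tendstoInMeasure_of_tendsto_Lp hlim).exists_seq_tendsto_ae
  have hconv : ∀ᵐ ω ∂P, Tendsto (fun n => Zn (ns n) ω) atTop (𝓝 (w ω)) := by
    have : ∀ᵐ ω ∂P, ∀ n, wn n ω = Zn n ω := ae_all_iff.2 fun n => by
      rw [← hZw n]; exact coeFn_lpIncl _ _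
    filter_upwards [hns, this] with ω h1 h2
    simpa only [h2] using h1
  have hbd : ∀ᵐ ω ∂P, |w ω| ≤ m := by
    have : ∀ᵐ ω ∂P, ∀ n, |Zn n ω| ≤ m :=
      ae_all_iff.2 fun n => (LInfty.norm_le_iff _ hm).1 (hs _ (hZn n))
    filter_upwards [hconv, this] with ω h1 h2
    exact le_of_tendsto h1.abs (Eventually.of_forall fun n => h2 _)
  have hmem : MemLp w ∞ P := memLp_top_of_bound (Lp.aestronglyMeasurable w) m hbd
  refine ⟨hmem.toLp w, hcl (fun n => Zn (ns n)) _ (fun n => hZn _) ?_ ?_, ?_⟩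
  · rw [LInfty.norm_le_iff _ hm]
    filter_upwards [hbd, hmem.coeFn_toLp] with ω h1 h2
    rwa [h2]
  · filter_upwards [hconv, hmem.coeFn_toLp] with ω h1 h2
    rwa [h2]
  · refine Lp.ext ?_
    filter_upwards [coeFn_lpIncl (p := 2) le_top (hmem.toLp w), hmem.coeFn_toLp] with ω h1 h2
    rw [h1, h2]

end LInfinity

/-! ### Convex monetary functionals on `L^∞` -/

section Monetary

variable {Ω : Type*} [mΩ : MeasurableSpace Ω] {P : Measure Ω} [IsProbabilityMeasure P]

/-- A monotone, cash-additive, convex, normalized functional on `L^∞` that is continuous from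
below. -/
structure IsMonetary (Φ : Lp ℝ ∞ P → ℝ) : Prop where
  mono : Monotone Φ
  add_const : ∀ X c, Φ (X + Lp.const ∞ P c) = Φ X + c
  convex : ConvexOn ℝ Set.univ Φ
  zero : Φ 0 = 0
  below : ∀ (Xn : ℕ → Lp ℝ ∞ P) (X : Lp ℝ ∞ P), Monotone Xn →
    (∀ᵐ ω ∂P, Tendsto (fun n => Xn n ω) atTop (𝓝 (X ω))) →
    Tendsto (fun n => Φ (Xn n)) atTop (𝓝 (Φ X))

variable {Φ : Lp ℝ ∞ P → ℝ}

theorem LInfty.le_const_norm (Z : Lp ℝ ∞ P) : Z ≤ Lp.const ∞ P ‖Z‖ := by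
  rw [← Lp.coeFn_le]
  filter_upwards [LInfty.ae_abs_le_norm Z, Lp.coeFn_const (p := ∞) (μ := P) ‖Z‖] with ω h1 h2
  rw [h2]
  exact (le_abs_self _).trans h1

theorem IsMonetary.sub_norm_le (hΦ : IsMonetary Φ) (X Z : Lp ℝ ∞ P) :
    Φ X - ‖Z‖ ≤ Φ (X - Z) := by
  have h : X ≤ X - Z + Lp.const ∞ P ‖Z‖ := by
    rw [sub_add_eq_add_sub, le_sub_iff_add_le]
    gcongr
    exact LInfty.le_const_norm Z
  have := hΦ.mono h
  rw [hΦ.add_const] at this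
  linarith

/-- Lower semicontinuity under bounded almost sure convergence. -/
theorem IsMonetary.le_of_tendsto_ae (hΦ : IsMonetary Φ) {Wn : ℕ → Lp ℝ ∞ P} {W : Lp ℝ ∞ P}
    {m c : ℝ} (hm : ∀ n, ‖Wn n‖ ≤ m) (hc : ∀ n, Φ (Wn n) ≤ c)
    (hlim : ∀ᵐ ω ∂P, Tendsto (fun n => Wn n ω) atTop (𝓝 (W ω))) : Φ W ≤ c := by
  have hbd : ∀ᵐ ω ∂P, ∀ n, |Wn n ω| ≤ m := ae_all_iff.2 fun n =>
    (LInfty.ae_abs_le_norm (Wn n)).mono fun ω h => h.trans (hm n)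
  have hbb : ∀ ω, (∀ n, |Wn n ω| ≤ m) → ∀ j, BddBelow (Set.range fun n => Wn (n + j) ω) :=
    fun ω h j => ⟨-m, by rintro _ ⟨n, rfl⟩; exact (abs_le.1 (h _)).1⟩
  -- Fatou argument: the tail infima increase almost surely to `W`, so continuity from below applies
  -- to them, and each lies below `Wn j`, hence has price at most `c`.
  have hmem : ∀ j, MemLp (fun ω => ⨅ n, Wn (n + j) ω) ∞ P := fun j => by
    refine memLp_top_of_bound (AEMeasurable.iInf fun n =>
      (Lp.stronglyMeasurable (Wn (n + j))).measurable.aemeasurable).aestronglyMeasurable m ?_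
    filter_upwards [hbd] with ω h
    rw [Real.norm_eq_abs, abs_le]
    exact ⟨le_ciInf fun n => (abs_le.1 (h _)).1,
      (ciInf_le (hbb ω h j) 0).trans (abs_le.1 (h _)).2⟩
  have hU : ∀ᵐ ω ∂P, ∀ j, (hmem j).toLp _ ω = ⨅ n, Wn (n + j) ω :=
    ae_all_iff.2 fun j => (hmem j).coeFn_toLp
  refine le_of_tendsto (hΦ.below (fun j => (hmem j).toLp _) W ?_ ?_)
    (Eventually.of_forall fun j => (hΦ.mono ?_).trans (hc j))
  · refine monotone_nat_of_le_succ fun j => ?_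
    rw [← Lp.coeFn_le]
    filter_upwards [hU, hbd] with ω h1 h2
    rw [h1, h1]
    refine le_ciInf fun n => (ciInf_le (hbb ω h2 j) (n + 1)).trans_eq ?_
    rw [add_assoc, add_comm 1 j]
  · filter_upwards [hU, hbd, hlim] with ω h1 h2 h3
    simp only [h1]
    rw [tendsto_order] at h3 ⊢
    refine ⟨fun a ha => ?_, fun a ha => ?_⟩
    · obtain ⟨b, hab, hb⟩ := exists_between ha
      obtain ⟨N, hN⟩ := eventually_atTop.1 (h3.1 b hb)
      filter_upwards [eventually_ge_atTop N] with j hj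
      exact hab.trans_le (le_ciInf fun n => (hN _ (by omega)).le)
    · filter_upwards [h3.2 a ha] with j hj
      have := ciInf_le (hbb ω h2 j) 0
      rw [zero_add] at this
      exact this.trans_lt hj
  · rw [← Lp.coeFn_le]
    filter_upwards [hU, hbd] with ω h1 h2
    rw [h1]
    have := ciInf_le (hbb ω h2 j) 0
    rwa [zero_add] at this

/-- A small perturbation in `L^1` that detects the values of `Z` above the level `m`. -/
theorem exists_pairing_ge_of_norm_gt {Z : Lp ℝ ∞ P} {m η : ℝ} (hm : 0 ≤ m) (hη : 0 ≤ η)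
    (hZ : m < ‖Z‖) : ∃ h : Lp ℝ 2 P, ‖lpIncl (p := 1) one_le_two h‖ ≤ η ∧
      η * m ≤ pairing P Z (lpIncl one_le_two h) := by
  set A : Set Ω := {ω | m < |Z ω|} with hA
  have hZm := (Lp.stronglyMeasurable Z).measurable
  have hAm : MeasurableSet A := measurableSet_lt measurable_const (by fun_prop)
  have hPA : 0 < P.real A := by
    rw [measureReal_def, ENNReal.toReal_pos_iff]
    refine ⟨pos_iff_ne_zero.2 fun h0 => hZ.not_ge ?_, measure_lt_top P A⟩
    rw [LInfty.norm_le_iff _ hm, ae_iff]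
    simpa using h0
  -- The perturbation is `c` times the sign of `Z` on `A`; this `c` gives it L^1-norm exactly `η`.
  set c : ℝ := η / P.real A with hc
  have hc0 : 0 ≤ c := by positivity
  have hcA : P.real A * c = η := by rw [hc]; field_simp
  let k : Ω → ℝ := A.indicator fun ω => if 0 ≤ Z ω then c else -c
  have hkm : Measurable k :=
    (Measurable.ite (measurableSet_le measurable_const hZm) measurable_const
      measurable_const).indicator hAm
  have hkabs : ∀ ω, ‖k ω‖ = A.indicator (fun _ => c) ω := fun ω => by
    by_cases hω : ω ∈ A
    · simp only [k, Set.indicator_of_mem hω]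
      split_ifs <;> simp [abs_of_nonneg hc0]
    · simp [k, hω]
  have hk2 : MemLp k 2 P := MemLp.of_bound hkm.aestronglyMeasurable c <|
    Eventually.of_forall fun ω => by
      rw [hkabs]; exact Set.indicator_le_self' (fun _ _ => hc0) ω
  have hcoe : lpIncl (p := 1) one_le_two (hk2.toLp k) =ᵐ[P] k :=
    (coeFn_lpIncl _ _).trans hk2.coeFn_toLp
  refine ⟨hk2.toLp k, ?_, ?_⟩
  · rw [L1.norm_eq_integral_norm]
    refine le_of_eq ((integral_congr_ae (hcoe.fun_comp (‖·‖))).trans ?_)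
    simp only [Function.comp_apply, hkabs]
    rw [integral_indicator_const _ hAm, smul_eq_mul, hcA]
  · have h1 : η * m = ∫ ω, A.indicator (fun _ => c * m) ω ∂P := by
      rw [integral_indicator_const _ hAm, smul_eq_mul, ← mul_assoc, hcA]
    rw [h1, pairing_apply]
    refine integral_mono_ae ((integrable_const _).indicator hAm)
      (LInfty.integrable_mul (L1.integrable_coeFn _) Z) ?_
    filter_upwards [hcoe] with ω hω
    rw [hω]
    by_cases hωA : ω ∈ A
    · have hlt : m < |Z ω| := hωA
      simp only [k, Set.indicator_of_mem hωA]
      split_ifs with h0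
      · rw [abs_of_nonneg h0] at hlt
        nlinarith
      · rw [abs_of_neg (not_le.1 h0)] at hlt
        nlinarith
    · simp [k, hωA]

theorem IsMonetary.convexOn_sub (hΦ : IsMonetary Φ) (X : Lp ℝ ∞ P) :
    ConvexOn ℝ Set.univ fun Z => Φ (X - Z) := by
  refine ⟨convex_univ, fun Z _ W _ a b ha hb hab => ?_⟩
  have h : X - (a • Z + b • W) = a • (X - Z) + b • (X - W) := by
    rw [smul_sub, smul_sub, sub_add_sub_comm, ← add_smul, hab, one_smul]
  simp only [h]
  exact hΦ.convex.2 (Set.mem_univ _) (Set.mem_univ _) ha hb hab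

/-- An approximate subgradient on the ball of radius `m` can be perturbed into an approximate
subgradient on the ball of radius `2 m`. -/
theorem IsMonetary.exists_subgradient_double (hΦ : IsMonetary Φ) (X : Lp ℝ ∞ P) {m η a b : ℝ}
    (hm : 0 ≤ m) (hη : 0 ≤ η) (hba : b < a) (hηm : Φ X - a ≤ η * m) (g : Lp ℝ 2 P)
    (hg : ∀ Z : Lp ℝ ∞ P, ‖Z‖ ≤ m → a ≤ Φ (X - Z) + pairing P Z (lpIncl one_le_two g)) :
    ∃ g' : Lp ℝ 2 P, ‖lpIncl (p := 1) one_le_two g' - lpIncl one_le_two g‖ ≤ η ∧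
      ∀ Z : Lp ℝ ∞ P, ‖Z‖ ≤ 2 * m →
        b ≤ Φ (X - Z) + pairing P Z (lpIncl one_le_two g') := by
  have h2m : 0 ≤ 2 * m := by positivity
  have hcb : {Z : Lp ℝ ∞ P | ‖Z‖ ≤ 2 * m} = Metric.closedBall 0 (2 * m) := by ext; simp
  have hKc : Convex ℝ {Z : Lp ℝ ∞ P | ‖Z‖ ≤ 2 * m} := hcb ▸ convex_closedBall _ _
  have hYc : Convex ℝ {y : Lp ℝ 2 P | ‖lpIncl (p := 1) one_le_two y - lpIncl one_le_two g‖ ≤ η} := by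
    have : {y : Lp ℝ 2 P | ‖lpIncl (p := 1) one_le_two y - lpIncl one_le_two g‖ ≤ η} =
        lpIncl (P := P) (p := 1) one_le_two ⁻¹' Metric.closedBall (lpIncl one_le_two g) η := by
      ext; simp [dist_eq_norm]
    rw [this]
    exact (convex_closedBall _ _).linear_preimage _
  have hconv := hΦ.convexOn_sub X
  suffices h : ∃ y ∈ {y : Lp ℝ 2 P |
      ‖lpIncl (p := 1) one_le_two y - lpIncl one_le_two g‖ ≤ η}, ∀ Z ∈ {Z : Lp ℝ ∞ P | ‖Z‖ ≤ 2 * m},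
      b < Φ (X - Z) + inner ℝ y (lpIncl (p := 2) le_top Z) by
    obtain ⟨y, hy, hyZ⟩ := h
    exact ⟨y, hy, fun Z hZ => by rw [← inner_lpIncl]; exact (hyZ Z hZ).le⟩
  refine exists_uniform_of_forall_exists (lpIncl (P := P) (p := 2) le_top)
    (lpIncl_injective _) hKc ⟨0, by simpa using h2m⟩ ?_
    (isClosed_lpIncl_image h2m (fun _ h => h) fun _ _ _ h _ => h)
    (hconv.subset (Set.subset_univ _) hKc) ?_ hYc (t := b) ?_
  · refine isBounded_iff_forall_norm_le.2 ⟨2 * m, ?_⟩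
    rintro _ ⟨Z, hZ, rfl⟩
    have := Lp.norm_le_of_ae_bound (f := lpIncl (P := P) (p := 2) le_top Z) h2m (by
      filter_upwards [coeFn_lpIncl (p := 2) le_top Z, LInfty.ae_abs_le_norm Z] with ω h1 h2
      rw [h1]
      exact h2.trans hZ)
    simpa [measureUnivNNReal] using this
  · intro c
    refine isClosed_lpIncl_image h2m (fun _ h => h.1) fun Zn Z hZn hZ hlim => ⟨hZ, ?_⟩
    refine hΦ.le_of_tendsto_ae (Wn := fun n => X - Zn n) (m := ‖X‖ + 2 * m)
      (fun n => (norm_sub_le _ _).trans (by gcongr; exact (hZn n).1)) (fun n => (hZn n).2) ?_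
    have h1 : ∀ᵐ ω ∂P, ∀ n, (X - Zn n : Lp ℝ ∞ P) ω = X ω - Zn n ω :=
      ae_all_iff.2 fun n => Lp.coeFn_sub X (Zn n)
    filter_upwards [h1, Lp.coeFn_sub X Z, hlim] with ω h1 h2 h3
    simp only [h1, h2, Pi.sub_apply]
    exact tendsto_const_nhds.sub h3
  · intro Z hZ
    by_cases hZm : ‖Z‖ ≤ m
    · exact ⟨g, by simpa using hη, hba.trans_le ((hg Z hZm).trans_eq (by rw [inner_lpIncl]))⟩
    · obtain ⟨h, hh1, hh2⟩ := exists_pairing_ge_of_norm_gt hm hη (not_le.1 hZm)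
      refine ⟨g + h, by simpa using hh1, ?_⟩
      rw [inner_lpIncl, map_add, map_add]
      -- `Z / 2` lies in the small ball. Convexity between 0 and `Z` gives Φ(X - Z) + ⟨Z, g⟩ ≥ 2a -
      -- Φ(X), and the perturbation adds at least η m ≥ Φ(X) - a, for a total of at least a > b.
      have h3 := hg ((1 / 2 : ℝ) • Z) (by rw [norm_smul]; norm_num; linarith [hZ.out])
      have h4 := hconv.2 (Set.mem_univ Z) (Set.mem_univ 0)
        (show (0 : ℝ) ≤ 1 / 2 by norm_num) (show (0 : ℝ) ≤ 1 / 2 by norm_num) (by norm_num)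
      simp only [smul_zero, add_zero, sub_zero, smul_eq_mul] at h4
      rw [map_smul, LinearMap.smul_apply, smul_eq_mul] at h3
      linarith

/-- Iterating the doubling step gives multipliers on balls of radius tending to infinity that form a
Cauchy sequence in L^1; the limit works for all `Z`. -/
theorem IsMonetary.exists_subgradient_signed (hΦ : IsMonetary Φ) (X : Lp ℝ ∞ P) {ε : ℝ}
    (hε : 0 < ε) : ∃ g : Lp ℝ 1 P, ∀ Z : Lp ℝ ∞ P, Φ X - ε ≤ Φ (X - Z) + pairing P Z g := by
  -- The levels decrease strictly from Φ(X) - ε/2 to Φ(X) - ε, as each step needs a strict loss. The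
  -- product `η n * m n` is always ε ≥ Φ(X) - `a n`, while the `η n` are summable.
  let a : ℕ → ℝ := fun n => Φ X - ε + (ε / 2) * (1 / 2) ^ n
  let m : ℕ → ℝ := fun n => (ε / 2) * 2 ^ n
  let η : ℕ → ℝ := fun n => 2 * (1 / 2) ^ n
  let S : ℕ → Lp ℝ 2 P → Prop := fun n g => ∀ Z : Lp ℝ ∞ P, ‖Z‖ ≤ m n →
    a n ≤ Φ (X - Z) + pairing P Z (lpIncl one_le_two g)
  have hstep : ∀ n g, S n g → ∃ g' : Lp ℝ 2 P,
      ‖lpIncl (p := 1) one_le_two g' - lpIncl one_le_two g‖ ≤ η n ∧ S (n + 1) g' := by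
    intro n g hg
    have hp : (0 : ℝ) < (1 / 2) ^ n := by positivity
    obtain ⟨g', h1, h2⟩ := hΦ.exists_subgradient_double X (m := m n) (η := η n) (a := a n)
      (b := a (n + 1)) (by positivity) (by positivity) (by simp only [a, pow_succ]; nlinarith)
      (by
        have : η n * m n = ε := by
          simp only [η, m]
          rw [show 2 * (1 / 2 : ℝ) ^ n * (ε / 2 * 2 ^ n) = ε * ((1 / 2) * 2) ^ n by
            rw [mul_pow]; ring]
          norm_num
        rw [this]; simp only [a]; nlinarith) g hg
    exact ⟨g', h1, fun Z hZ => h2 Z (by simp only [m, pow_succ] at hZ ⊢; linarith)⟩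
  have h0 : S 0 0 := fun Z hZ => by
    have := hΦ.sub_norm_le X Z
    simp only [m, a, pow_zero, mul_one, map_zero, add_zero] at hZ ⊢
    linarith
  choose! next hn1 hn2 using hstep
  let G : ℕ → Lp ℝ 2 P := fun n => Nat.rec 0 (fun k g => next k g) n
  have hG : ∀ n, S n (G n) := fun n => by
    induction n with
    | zero => exact h0
    | succ k ih => exact hn2 k _ ih
  have hcauchy : CauchySeq fun n => lpIncl (p := 1) one_le_two (G n) := by
    refine cauchySeq_of_le_geometric (1 / 2) 2 (by norm_num) fun n => ?_
    rw [dist_comm, dist_eq_norm]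
    exact hn1 n _ (hG n)
  obtain ⟨g, hg⟩ := cauchySeq_tendsto_of_complete hcauchy
  refine ⟨g, fun Z => ?_⟩
  refine ge_of_tendsto (tendsto_const_nhds.add (((continuous_pairing Z).tendsto g).comp hg)) ?_
  have hmt : Tendsto m atTop atTop :=
    (tendsto_pow_atTop_atTop_of_one_lt one_lt_two).const_mul_atTop (by positivity)
  filter_upwards [hmt.eventually_ge_atTop ‖Z‖] with n hn
  refine le_trans ?_ (hG n Z hn)
  have : (0 : ℝ) ≤ ε / 2 * (1 / 2) ^ n := by positivity
  simp only [a]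
  linarith

/-- A density of a probability measure. -/
structure IsDensity (g : Lp ℝ 1 P) : Prop where
  nonneg : 0 ≤ g
  integral_eq_one : ∫ ω, g ω ∂P = 1

/-- Robust representation: approximate subgradients of a convex monetary functional that are
densities of probability measures. -/
theorem IsMonetary.exists_density (hΦ : IsMonetary Φ) (X : Lp ℝ ∞ P) {ε : ℝ} (hε : 0 < ε) :
    ∃ g : Lp ℝ 1 P, IsDensity g ∧
      ∀ Y : Lp ℝ ∞ P, pairing P Y g - Φ Y ≤ pairing P X g - Φ X + ε := by
  obtain ⟨g, hg⟩ := hΦ.exists_subgradient_signed X hε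
  have hY : ∀ Y : Lp ℝ ∞ P, pairing P Y g - Φ Y ≤ pairing P X g - Φ X + ε := fun Y => by
    have := hg (X - Y)
    rw [sub_sub_cancel, map_sub, LinearMap.sub_apply] at this
    linarith
  -- A linear function of `c` bounded above on ℝ is zero, which forces total mass 1. Nonnegativity
  -- follows likewise from large negative multiples of indicators.
  have h_const : ∀ c : ℝ, c * (∫ ω, g ω ∂P - 1) ≤ pairing P X g - Φ X + ε := fun c => by
    have h1 := hY (0 + Lp.const ∞ P c)
    rw [hΦ.add_const, hΦ.zero, zero_add, pairing_const] at h1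
    linarith
  refine ⟨g, ⟨?_, ?_⟩, hY⟩
  · rw [← Lp.coeFn_nonneg]
    refine ae_nonneg_of_forall_setIntegral_nonneg (L1.integrable_coeFn g) fun A hA _ => ?_
    by_contra! hneg
    have h2 : ∀ n : ℕ, -(n : ℝ) * ∫ ω in A, g ω ∂P ≤ pairing P X g - Φ X + ε := fun n => by
      have h3 := hY (indicatorConstLp ∞ hA (measure_ne_top P A) (-(n : ℝ)))
      have h4 : Φ (indicatorConstLp ∞ hA (measure_ne_top P A) (-(n : ℝ))) ≤ 0 := by
        rw [← hΦ.zero]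
        refine hΦ.mono ?_
        rw [← Lp.coeFn_le]
        filter_upwards [indicatorConstLp_coeFn (p := ∞) (hs := hA) (hμs := measure_ne_top P A)
          (c := -(n : ℝ)), Lp.coeFn_zero ℝ ∞ P] with ω h5 h6
        rw [h5, h6]
        exact Set.indicator_nonpos (fun _ _ => by simp) ω
      rw [pairing_indicator] at h3
      linarith
    obtain ⟨n, hn⟩ := exists_nat_gt ((pairing P X g - Φ X + ε) / -∫ ω in A, g ω ∂P)
    rw [div_lt_iff₀ (by linarith)] at hn
    linarith [h2 n]
  · by_contra hne
    have hne' : ∫ ω, g ω ∂P - 1 ≠ 0 := sub_ne_zero.2 hne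
    have := h_const ((pairing P X g - Φ X + ε + 1) / (∫ ω, g ω ∂P - 1))
    rw [div_mul_cancel₀ _ hne'] at this
    linarith

end Monetary

/-! ### The Kreps-Yan theorem -/

section KrepsYan

variable {Ω : Type*} [mΩ : MeasurableSpace Ω] {P : Measure Ω}

/-- Hahn-Banach applies in the locally convex space `WeakBilin (pairing P)`, whose continuous
functionals are exactly the pairings with L^1. Scaling within the cone pushes the separating bound
on `C` down to 0. -/
theorem exists_pairing_separation {C : Set (Lp ℝ ∞ P)} (hC : Convex ℝ C)
    (hcone : ∀ W ∈ C, ∀ c : ℝ, 0 ≤ c → c • W ∈ C) (h0 : 0 ∈ C) {Z : Lp ℝ ∞ P}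
    (hZ : Z ∉ @closure _ (weakStar P) C) :
    ∃ g : Lp ℝ 1 P, (∀ W ∈ C, pairing P W g ≤ 0) ∧ 0 < pairing P Z g := by
  obtain ⟨f, u, hf1, hf2⟩ := geometric_hahn_banach_closed_point (E := WeakBilin (pairing P))
    (s := closure C) (x := Z) (Convex.closure (E := WeakBilin (pairing P)) hC) isClosed_closure hZ
  obtain ⟨g, hg⟩ := LinearMap.dualEmbedding_surjective (pairing P) f
  have hfg : ∀ W : Lp ℝ ∞ P, pairing P W g = f W := fun W => by rw [← hg]; rfl
  have hCu : ∀ W ∈ C, pairing P W g < u := fun W hW => by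
    rw [hfg]
    exact hf1 W (subset_closure (X := WeakBilin (pairing P)) hW)
  have hu : 0 < u := by simpa using hCu 0 h0
  refine ⟨g, fun W hW => ?_, hu.trans (by rw [hfg]; exact hf2)⟩
  by_contra! hpos
  have h1 := hCu _ (hcone W hW (u / pairing P W g) (by positivity))
  rw [map_smul, LinearMap.smul_apply, smul_eq_mul, div_mul_cancel₀ _ hpos.ne'] at h1
  exact lt_irrefl _ h1

variable [IsProbabilityMeasure P]

theorem nonneg_of_forall_pairing_nonpos {g : Lp ℝ 1 P}
    (hg : ∀ W : Lp ℝ ∞ P, W ≤ 0 → pairing P W g ≤ 0) : 0 ≤ g := by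
  rw [← Lp.coeFn_nonneg]
  refine ae_nonneg_of_forall_setIntegral_nonneg (L1.integrable_coeFn g) fun A hA _ => ?_
  have h := hg (indicatorConstLp ∞ hA (measure_ne_top P A) (-1)) (by
    rw [← Lp.coeFn_le]
    filter_upwards [indicatorConstLp_coeFn (p := ∞) (hs := hA) (hμs := measure_ne_top P A)
      (c := (-1 : ℝ)), Lp.coeFn_zero ℝ ∞ P] with ω h5 h6
    rw [h5, h6]
    exact Set.indicator_nonpos (fun _ _ => by simp) ω)
  rw [pairing_indicator] at h
  linarith

/-- A convex cone of nonnegative integrable functions that is stable under countable sums and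
charges every set of positive measure contains an almost surely positive function. -/
theorem exists_ae_pos_of_exhaustion {G : Set (Lp ℝ 1 P)} (h0 : 0 ∈ G) (hG : ∀ g ∈ G, 0 ≤ g)
    (hadd : ∀ g ∈ G, ∀ h ∈ G, g + h ∈ G) (hsmul : ∀ g ∈ G, ∀ c : ℝ, 0 ≤ c → c • g ∈ G)
    (hsum : ∀ g : ℕ → Lp ℝ 1 P, (∀ n, g n ∈ G) → Summable g → ∑' n, g n ∈ G)
    (hex : ∀ A, MeasurableSet A → P A ≠ 0 → ∃ g ∈ G, 0 < ∫ ω in A, g ω ∂P) :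
    ∃ g ∈ G, ∀ᵐ ω ∂P, 0 < g ω := by
  let v : Lp ℝ 1 P → ℝ := fun g => P.real {ω | 0 < g ω}
  have hpm : ∀ g : Lp ℝ 1 P, MeasurableSet {ω | 0 < g ω} := fun g =>
    measurableSet_lt measurable_const (Lp.stronglyMeasurable g).measurable
  have hmono : ∀ (g h : Lp ℝ 1 P) (c : ℝ), 0 < c → c • g ≤ h → v g ≤ v h := by
    intro g h c hc hgh
    refine ENNReal.toReal_mono (measure_ne_top _ _) (measure_mono_ae ?_)
    filter_upwards [(Lp.coeFn_le _ _).2 hgh, Lp.coeFn_smul c g] with ω h1 h2 h3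
    rw [h2] at h1
    exact (mul_pos hc h3).trans_le h1
  obtain ⟨u, -, hu, huG⟩ := exists_seq_tendsto_sSup (S := v '' G) ⟨_, 0, h0, rfl⟩
    ⟨1, by rintro _ ⟨g, -, rfl⟩; exact measureReal_le_one⟩
  choose g hgG hgu using huG
  -- These weights make a maximizing sequence summable. The sum dominates a positive multiple of
  -- each term, so its positivity set has the largest possible measure.
  let c : ℕ → ℝ := fun n => (1 / 2) ^ n / (1 + ‖g n‖)
  have hc : ∀ n, 0 < c n := fun n => by positivity
  have hcs : Summable fun n => c n • g n := by
    refine Summable.of_norm_bounded summable_geometric_two fun n => ?_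
    rw [norm_smul, Real.norm_of_nonneg (hc n).le, div_mul_eq_mul_div]
    refine div_le_of_le_mul₀ (by positivity) (by positivity) ?_
    gcongr
    linarith
  set s := ∑' n, c n • g n with hs
  have hsG : s ∈ G := hsum _ (fun n => hsmul _ (hgG n) _ (hc n).le) hcs
  have hle : ∀ n, c n • g n ≤ s := fun n =>
    hcs.le_tsum n fun k _ => hG _ (hsmul _ (hgG k) _ (hc k).le)
  have hsup : sSup (v '' G) ≤ v s := le_of_tendsto hu (Eventually.of_forall fun n => by
    rw [← hgu n]; exact hmono _ _ _ (hc n) (hle n))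
  refine ⟨s, hsG, ?_⟩
  by_contra hne
  set A : Set Ω := {ω | 0 < s ω}ᶜ with hA
  have hAm : MeasurableSet A := (hpm s).compl
  obtain ⟨h, hhG, hh⟩ := hex A hAm hne
  have hAh : 0 < P.real (A ∩ {ω | 0 < h ω}) := by
    rw [measureReal_def, ENNReal.toReal_pos_iff]
    refine ⟨pos_iff_ne_zero.2 fun h1 => hh.not_ge ?_, measure_lt_top _ _⟩
    refine setIntegral_nonpos_of_ae_restrict ?_
    rw [EventuallyLE, ae_restrict_iff' hAm]
    filter_upwards [measure_eq_zero_iff_ae_notMem.1 h1] with ω h2 h3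
    by_contra h4
    exact h2 ⟨h3, not_le.1 h4⟩
  have hlt : v s < v (s + h) := by
    have hsub : v s + P.real (A ∩ {ω | 0 < h ω}) ≤ v (s + h) := by
      rw [← measureReal_union (disjoint_compl_right.mono_right Set.inter_subset_left)
        (hAm.inter (hpm h))]
      refine ENNReal.toReal_mono (measure_ne_top _ _) (measure_mono_ae ?_)
      filter_upwards [Lp.coeFn_add s h, (Lp.coeFn_nonneg _).2 (hG s hsG),
        (Lp.coeFn_nonneg _).2 (hG h hhG)] with ω h1 h2 h3 h4
      change 0 < (s + h) ω
      rw [h1]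
      rcases h4 with h4 | h4
      · exact add_pos_of_pos_of_nonneg h4 h3
      · exact add_pos_of_nonneg_of_pos h2 h4.2
    linarith
  have := le_csSup (s := v '' G) ⟨1, by rintro _ ⟨g, -, rfl⟩; exact measureReal_le_one⟩
    ⟨s + h, hadd _ hsG _ hhG, rfl⟩
  linarith

/-- Kreps-Yan: a convex cone that contains the nonpositive functions and whose weak* closure meets
the nonnegative functions only in `0` is polar to the density of an equivalent probability. -/
theorem exists_equivalent_density {C : Set (Lp ℝ ∞ P)} (hC : Convex ℝ C)
    (hcone : ∀ W ∈ C, ∀ c : ℝ, 0 ≤ c → c • W ∈ C) (hneg : ∀ W : Lp ℝ ∞ P, W ≤ 0 → W ∈ C)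
    (hNFL : @closure _ (weakStar P) C ∩ {W | 0 ≤ W} = {0}) :
    ∃ r : Lp ℝ 1 P, IsDensity r ∧ (∀ᵐ ω ∂P, 0 < r ω) ∧ ∀ W ∈ C, pairing P W r ≤ 0 := by
  obtain ⟨g, hgC, hg⟩ := exists_ae_pos_of_exhaustion (P := P)
    (G := {g | ∀ W ∈ C, pairing P W g ≤ 0}) (by simp)
    (fun g hg => nonneg_of_forall_pairing_nonpos fun W hW => hg W (hneg W hW))
    (fun g hg h hh W hW => by rw [map_add]; exact add_nonpos (hg W hW) (hh W hW))
    (fun g hg c hc W hW => by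
      rw [map_smul]; exact mul_nonpos_of_nonneg_of_nonpos hc (hg W hW))
    (fun g hg hs W hW => by
      have h1 := hs.hasSum.map (pairing P W) (continuous_pairing W)
      rw [← h1.tsum_eq]
      exact tsum_nonpos fun n => hg n W hW)
    (fun A hA hPA => by
      have hcoe := indicatorConstLp_coeFn (p := ∞) (hs := hA) (hμs := measure_ne_top P A)
        (c := (1 : ℝ))
      have hnot : indicatorConstLp ∞ hA (measure_ne_top P A) (1 : ℝ) ∉
          @closure _ (weakStar P) C := fun hmem => by
        have h1 : indicatorConstLp ∞ hA (measure_ne_top P A) (1 : ℝ) ∈ ({0} : Set (Lp ℝ ∞ P)) := by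
          rw [← hNFL]
          refine ⟨hmem, ?_⟩
          rw [Set.mem_ofPred_eq, ← Lp.coeFn_nonneg]
          filter_upwards [hcoe] with ω h
          rw [h]
          exact Set.indicator_nonneg (fun _ _ => zero_le_one) ω
        refine hPA (measure_eq_zero_iff_ae_notMem.2 ?_)
        rw [Set.mem_singleton_iff] at h1
        rw [h1] at hcoe
        filter_upwards [hcoe, Lp.coeFn_zero ℝ ∞ P] with ω h2 h3 h4
        rw [h3, Set.indicator_of_mem h4] at h2
        exact zero_ne_one h2
      obtain ⟨g, hg1, hg2⟩ := exists_pairing_separation hC hcone (hneg 0 le_rfl) hnot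
      rw [pairing_indicator, one_mul] at hg2
      exact ⟨g, hg1, hg2⟩)
  have hpos : 0 < ∫ ω, g ω ∂P := by
    rw [integral_pos_iff_support_of_nonneg_ae (hg.mono fun _ h => h.le) (L1.integrable_coeFn g)]
    have : (Function.support g : Set Ω) =ᵐ[P] Set.univ :=
      eventuallyEq_univ.2 (hg.mono fun _ h => h.ne')
    rw [measure_congr this, measure_univ]
    exact one_pos
  refine ⟨(∫ ω, g ω ∂P)⁻¹ • g, ⟨?_, ?_⟩, ?_, fun W hW => ?_⟩
  · rw [← Lp.coeFn_nonneg]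
    filter_upwards [Lp.coeFn_smul (∫ ω, g ω ∂P)⁻¹ g, hg] with ω h1 h2
    rw [h1]
    exact (mul_pos (inv_pos.2 hpos) h2).le
  · rw [integral_congr_ae (Lp.coeFn_smul (∫ ω, g ω ∂P)⁻¹ g)]
    simp only [Pi.smul_apply, smul_eq_mul]
    rw [integral_const_mul, inv_mul_cancel₀ hpos.ne']
  · filter_upwards [Lp.coeFn_smul (∫ ω, g ω ∂P)⁻¹ g, hg] with ω h1 h2
    rw [h1]
    exact mul_pos (inv_pos.2 hpos) h2
  · rw [map_smul]
    exact mul_nonpos_of_nonneg_of_nonpos (inv_pos.2 hpos).le (hgC W hW)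

end KrepsYan

/-! ### Equivalent probability measures with a density -/

section Penalized

variable {Ω : Type*} [mΩ : MeasurableSpace Ω] {P : Measure Ω} [IsProbabilityMeasure P]
  {Φ : Lp ℝ ∞ P → ℝ}

/-- If a convex monetary functional dominates an equivalent probability measure, then its robust
representation may be restricted to equivalent probability measures. -/
theorem IsMonetary.exists_equivalent_density (hΦ : IsMonetary Φ) {r : Lp ℝ 1 P}
    (hr : IsDensity r) (hr_pos : ∀ᵐ ω ∂P, 0 < r ω) (hrΦ : ∀ X, pairing P X r ≤ Φ X)
    (X : Lp ℝ ∞ P) {t : ℝ} (ht : t < Φ X) :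
    ∃ (q : Lp ℝ 1 P) (c : ℝ), IsDensity q ∧ (∀ᵐ ω ∂P, 0 < q ω) ∧
      (∀ Y, pairing P Y q - Φ Y ≤ c) ∧ t < pairing P X q - c := by
  set ε := (Φ X - t) / 2 with hε
  have hε0 : 0 < ε := by rw [hε]; linarith
  obtain ⟨g, hg, hgY⟩ := hΦ.exists_density X hε0
  -- Since `r` has penalty at most 0, a mixture with weight `l` on `r` has penalty at most (1 - l)
  -- times that of `g` and reaches Φ(X) - ε + l K. The choice of `l` ensures l |K| < ε, and the term
  -- 2ε in the denominator keeps `l` < 1 even if K = 0.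
  set K := pairing P X r - Φ X + ε with hK
  set l := ε / (2 * ε + |K|) with hl
  have hden : 0 < 2 * ε + |K| := by positivity
  have hl0 : 0 < l := by positivity
  have hl1 : l < 1 := by rw [hl, div_lt_one hden]; linarith [abs_nonneg K]
  have hlK : l * |K| < ε := by
    have : l * (2 * ε + |K|) = ε := div_mul_cancel₀ _ hden.ne'
    nlinarith
  have hpair : ∀ Y, pairing P Y ((1 - l) • g + l • r) =
      (1 - l) * pairing P Y g + l * pairing P Y r := fun Y => by simp
  have hcoe : ∀ᵐ ω ∂P, ((1 - l) • g + l • r : Lp ℝ 1 P) ω = (1 - l) * g ω + l * r ω := by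
    filter_upwards [Lp.coeFn_add ((1 - l) • g) (l • r), Lp.coeFn_smul (1 - l) g,
      Lp.coeFn_smul l r] with ω h1 h2 h3
    rw [h1, Pi.add_apply, h2, h3]
    rfl
  have hpos : ∀ᵐ ω ∂P, 0 < ((1 - l) • g + l • r : Lp ℝ 1 P) ω := by
    filter_upwards [hcoe, hr_pos, (Lp.coeFn_nonneg _).2 hg.nonneg] with ω h1 h2 h3
    rw [h1]
    exact add_pos_of_nonneg_of_pos (mul_nonneg (by linarith) h3) (mul_pos hl0 h2)
  refine ⟨(1 - l) • g + l • r, (1 - l) * (pairing P X g - Φ X + ε), ⟨?_, ?_⟩, hpos, fun Y => ?_, ?_⟩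
  · rw [← Lp.coeFn_nonneg]
    exact hpos.mono fun _ h => h.le
  · rw [integral_congr_ae hcoe, integral_add ((L1.integrable_coeFn g).const_mul _)
      ((L1.integrable_coeFn r).const_mul _), integral_const_mul, integral_const_mul,
      hg.integral_eq_one, hr.integral_eq_one]
    ring
  · rw [hpair]
    nlinarith [hgY Y, hrΦ Y]
  · rw [hpair]
    have h1 : -|K| ≤ K := neg_abs_le K
    have h2 : l * (-|K|) ≤ l * K := mul_le_mul_of_nonneg_left h1 hl0.le
    have h3 : (1 - l) * pairing P X g + l * pairing P X r -
        (1 - l) * (pairing P X g - Φ X + ε) = Φ X - ε + l * K := by rw [hK]; ring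
    rw [h3]
    have : t = Φ X - 2 * ε := by rw [hε]; ring
    linarith

end Penalized

section Density

variable {Ω : Type*} [mΩ : MeasurableSpace Ω] {P : Measure Ω}

/-- The probability measure with density `q`. -/
noncomputable def densityMeasure (q : Lp ℝ 1 P) : Measure Ω :=
  P.withDensity fun ω => ((q ω).toNNReal : ℝ≥0∞)

theorem integral_densityMeasure {q : Lp ℝ 1 P} (hq : IsDensity q) (f : Ω → ℝ) :
    ∫ ω, f ω ∂densityMeasure q = ∫ ω, f ω * q ω ∂P := by
  rw [densityMeasure, integral_withDensity_eq_integral_smul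
    (Lp.stronglyMeasurable q).measurable.real_toNNReal]
  refine integral_congr_ae ?_
  filter_upwards [(Lp.coeFn_nonneg _).2 hq.nonneg] with ω h
  rw [NNReal.smul_def, Real.coe_toNNReal _ h, smul_eq_mul, mul_comm]

theorem integral_densityMeasure_eq_pairing {q : Lp ℝ 1 P} (hq : IsDensity q) (Z : Lp ℝ ∞ P) :
    ∫ ω, Z ω ∂densityMeasure q = pairing P Z q :=
  integral_densityMeasure hq _

theorem isProbabilityMeasure_densityMeasure {q : Lp ℝ 1 P} (hq : IsDensity q) :
    IsProbabilityMeasure (densityMeasure q) := ⟨by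
  rw [densityMeasure, withDensity_apply _ MeasurableSet.univ, Measure.restrict_univ]
  change ∫⁻ ω, ENNReal.ofReal (q ω) ∂P = 1
  rw [← ofReal_integral_eq_lintegral_ofReal (L1.integrable_coeFn q)
    ((Lp.coeFn_nonneg _).2 hq.nonneg), hq.integral_eq_one, ENNReal.ofReal_one]⟩

theorem densityMeasure_absolutelyContinuous (q : Lp ℝ 1 P) : densityMeasure q ≪ P :=
  withDensity_absolutelyContinuous _ _

theorem absolutelyContinuous_densityMeasure {q : Lp ℝ 1 P} (hq : ∀ᵐ ω ∂P, 0 < q ω) :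
    P ≪ densityMeasure q := by
  refine withDensity_absolutelyContinuous'
    (Lp.stronglyMeasurable q).measurable.real_toNNReal.coe_nnreal_ennreal.aemeasurable ?_
  filter_upwards [hq] with ω h
  simpa using h

end Density

/-! ### The price at time zero as a monetary functional -/

section TimeZero

variable {Ω : Type*} [mΩ : MeasurableSpace Ω] {P : Measure Ω} {𝓕 : Filtration ℝ≥0 mΩ}

theorem UsualConditions.measure_eq_zero_or (hF : UsualConditions P 𝓕) {s : Set Ω}
    (hs : MeasurableSet[𝓕 0] s) : P s = 0 ∨ P sᶜ = 0 := by
  rw [hF.zero_eq] at hs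
  induction s, hs using MeasurableSpace.generateFrom_induction with
  | hC t ht _ => exact Or.inl ht.2
  | empty => simp
  | compl t _ h => rw [compl_compl]; exact h.symm
  | iUnion f _ h =>
    by_cases h0 : ∀ n, P (f n) = 0
    · exact Or.inl (measure_iUnion_null h0)
    · push Not at h0
      obtain ⟨n, hn⟩ := h0
      exact Or.inr (measure_mono_null (Set.compl_subset_compl.2 (Set.subset_iUnion f n))
        ((h n).resolve_left hn))

theorem UsualConditions.exists_ae_eq_const [IsProbabilityMeasure P] (hF : UsualConditions P 𝓕)
    (Z : LInf P (StopTime.zero 𝓕)) : ∃ c : ℝ, (Z : Lp ℝ ∞ P) =ᵐ[P] fun _ => c := by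
  obtain ⟨f, hf, hZf⟩ := Z.2
  suffices h : ∃ c : ℝ, f =ᵐ[P] fun _ => c by
    obtain ⟨c, hc⟩ := h
    exact ⟨c, hZf.trans hc⟩
  refine exists_eventuallyEq_const_of_forall_separating MeasurableSet fun U hU => ?_
  have hm : MeasurableSet[𝓕 0] (f ⁻¹' U) := by
    rw [← StopTime.sigmaAlg_zero]
    exact hf.measurable hU
  rcases hF.measure_eq_zero_or hm with h | h
  · exact Or.inr (measure_eq_zero_iff_ae_notMem.1 h)
  · exact Or.inl (by simpa using measure_eq_zero_iff_ae_notMem.1 h)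

/-- `L^∞(F_∞)` is the whole of `L^∞`. -/
def LInf.ofLp (𝓕 : Filtration ℝ≥0 mΩ) (X : Lp ℝ ∞ P) : LInf P (StopTime.infty 𝓕) :=
  ⟨X, by
    rw [mem_lpMeas_iff_aestronglyMeasurable, StopTime.sigmaAlg_infty]
    exact Lp.aestronglyMeasurable X⟩

variable (Pi : PricingProcedure P 𝓕)

/-- The ask price at time `0`, as a number. -/
noncomputable def PricingProcedure.askZero (X : Lp ℝ ∞ P) : ℝ :=
  ∫ ω, (Pi.ask (StopTime.zero_le (StopTime.infty 𝓕)) (LInf.ofLp 𝓕 X) : Lp ℝ ∞ P) ω ∂P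

variable {Pi}

theorem PricingProcedure.ask_incl_self {σ τ : StopTime 𝓕} (h : σ ≤ τ) (Z : LInf P σ) :
    Pi.ask h (LInf.incl h Z) = Z := by
  have := Pi.translation h Z 0
  rwa [zero_add, Pi.normalized, zero_add] at this

/-- Π_{τ,∞} fixes F_τ-measurable payoffs, so by time consistency the time-zero price does not depend
on the maturity assigned to the payoff. -/
theorem PricingProcedure.ask_zero_ae_eq [IsProbabilityMeasure P] (hF : UsualConditions P 𝓕)
    (hTC : Pi.TimeConsistent) {τ : StopTime 𝓕} (Z : LInf P τ) :
    (Pi.ask (StopTime.zero_le τ) Z : Lp ℝ ∞ P) =ᵐ[P] fun _ => Pi.askZero (Z : Lp ℝ ∞ P) := by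
  have h1 : Pi.ask (StopTime.zero_le τ) Z =
      Pi.ask (StopTime.zero_le (StopTime.infty 𝓕)) (LInf.ofLp 𝓕 (Z : Lp ℝ ∞ P)) := by
    rw [← hTC _ τ _ (StopTime.zero_le τ) (StopTime.le_infty τ)]
    congr 1
    exact (PricingProcedure.ask_incl_self (StopTime.le_infty τ) Z).symm
  obtain ⟨c, hc⟩ := hF.exists_ae_eq_const (Pi.ask (StopTime.zero_le τ) Z)
  have h2 : Pi.askZero (Z : Lp ℝ ∞ P) = c := by
    rw [PricingProcedure.askZero, ← h1, integral_congr_ae hc]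
    simp
  rw [h2]
  exact hc

theorem PricingProcedure.isMonetary_askZero [IsProbabilityMeasure P] (hF : UsualConditions P 𝓕)
    (hPi : Pi.IsTCPP) : IsMonetary Pi.askZero := by
  have hae : ∀ X : Lp ℝ ∞ P,
      (Pi.ask (StopTime.zero_le (StopTime.infty 𝓕)) (LInf.ofLp 𝓕 X) : Lp ℝ ∞ P) =ᵐ[P]
        fun _ => Pi.askZero X := fun X =>
    PricingProcedure.ask_zero_ae_eq hF hPi.timeConsistent (LInf.ofLp 𝓕 X)
  refine ⟨fun X Y hXY => ?_, fun X c => ?_, ⟨convex_univ, fun X _ Y _ a b ha hb hab => ?_⟩, ?_,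
    fun Xn X hmono hlim => ?_⟩
  · have h := Pi.monotone (StopTime.zero_le (StopTime.infty 𝓕)) (LInf.ofLp 𝓕 X)
      (LInf.ofLp 𝓕 Y) hXY
    have h' := (Lp.coeFn_le _ _).2 h
    obtain ⟨ω, h1, h2, h3⟩ := (h'.and ((hae X).and (hae Y))).exists
    rwa [h2, h3] at h1
  · let Z : LInf P (StopTime.zero 𝓕) := ⟨Lp.const ∞ P c, ⟨fun _ => c,
      stronglyMeasurable_const, Lp.coeFn_const (p := ∞) (μ := P) c⟩⟩
    have h := Pi.translation (StopTime.zero_le (StopTime.infty 𝓕)) Z (LInf.ofLp 𝓕 X)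
    have h0 : LInf.ofLp 𝓕 X + LInf.incl (StopTime.zero_le (StopTime.infty 𝓕)) Z =
      LInf.ofLp 𝓕 (X + Lp.const ∞ P c) := rfl
    rw [h0] at h
    have h1 := hae (X + Lp.const ∞ P c)
    rw [h] at h1
    obtain ⟨ω, h2, h3, h4, h5⟩ := (h1.and ((hae X).and ((Lp.coeFn_const (p := ∞) (μ := P) c).and
      (Lp.coeFn_add (Pi.ask (StopTime.zero_le (StopTime.infty 𝓕)) (LInf.ofLp 𝓕 X) : Lp ℝ ∞ P)
        (Z : Lp ℝ ∞ P))))).exists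
    refine h2.symm.trans (h5.trans ?_)
    rw [_root_.Pi.add_apply, h3]
    change Pi.askZero X + (Lp.const ∞ P c : Lp ℝ ∞ P) ω = _
    rw [h4]
    rfl
  · have h := Pi.convex (StopTime.zero_le (StopTime.infty 𝓕)) (LInf.ofLp 𝓕 X) (LInf.ofLp 𝓕 Y)
      a ha (by linarith)
    rw [show 1 - a = b by linarith] at h
    have h0 : a • LInf.ofLp 𝓕 X + b • LInf.ofLp 𝓕 Y = LInf.ofLp 𝓕 (a • X + b • Y) := rfl
    rw [h0] at h
    set U := Pi.ask (StopTime.zero_le (StopTime.infty 𝓕)) (LInf.ofLp 𝓕 X) with hU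
    set V := Pi.ask (StopTime.zero_le (StopTime.infty 𝓕)) (LInf.ofLp 𝓕 Y) with hV
    have h' := (Lp.coeFn_le _ _).2 h
    obtain ⟨ω, h1, h2, h3, h4, h5, h6, h7⟩ := (h'.and ((hae (a • X + b • Y)).and ((hae X).and
      ((hae Y).and ((Lp.coeFn_add (a • (U : Lp ℝ ∞ P)) (b • (V : Lp ℝ ∞ P))).and
      ((Lp.coeFn_smul a (U : Lp ℝ ∞ P)).and (Lp.coeFn_smul b (V : Lp ℝ ∞ P)))))))).exists
    rw [h2] at h1
    refine h1.trans_eq (h5.trans ?_)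
    rw [_root_.Pi.add_apply, h6, h7, _root_.Pi.smul_apply, _root_.Pi.smul_apply, h3, h4]
  · have h1 := hae 0
    have h0 : LInf.ofLp (P := P) 𝓕 0 = 0 := rfl
    rw [h0, Pi.normalized] at h1
    obtain ⟨ω, h2, h3⟩ := (h1.and (Lp.coeFn_zero ℝ ∞ P)).exists
    exact h2.symm.trans h3
  · have h := hPi.continuousFromBelow _ _ (StopTime.zero_le (StopTime.infty 𝓕))
      (fun n => LInf.ofLp 𝓕 (Xn n)) (LInf.ofLp 𝓕 X) hmono hlim
    obtain ⟨ω, h1, h2, h3⟩ := (h.and ((ae_all_iff.2 fun n => hae (Xn n)).and (hae X))).exists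
    simpa only [h2, h3] using h1

/-- Kreps-Yan applied to the cone of zero-cost payoffs; since X - Φ(X) always belongs to this cone,
polarity becomes E_R(X) ≤ Φ(X). -/
theorem PricingProcedure.exists_equivalent_density_le_askZero [IsProbabilityMeasure P]
    (hF : UsualConditions P 𝓕) (hPi : Pi.IsTCPP) (hNFL : Pi.NoFreeLunch) :
    ∃ r : Lp ℝ 1 P, IsDensity r ∧ (∀ᵐ ω ∂P, 0 < r ω) ∧ ∀ X, pairing P X r ≤ Pi.askZero X := by
  have hΦ := PricingProcedure.isMonetary_askZero hF hPi
  have hC : Pi.zeroCostCone =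
      {W | ∃ (c : ℝ) (X : Lp ℝ ∞ P), 0 ≤ c ∧ Pi.askZero X ≤ 0 ∧ W = c • X} := by
    have hiff : ∀ X : LInf P (StopTime.infty 𝓕),
        Pi.ask (StopTime.zero_le _) X ≤ 0 ↔ Pi.askZero (X : Lp ℝ ∞ P) ≤ 0 := fun X => by
      have h1 := PricingProcedure.ask_zero_ae_eq hF hPi.timeConsistent X
      rw [← Subtype.coe_le_coe, ← Lp.coeFn_le]
      have h2 : ((0 : LInf P (StopTime.zero 𝓕)) : Lp ℝ ∞ P) =ᵐ[P] 0 := Lp.coeFn_zero ℝ ∞ P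
      constructor
      · intro h
        obtain ⟨ω, h3, h4, h5⟩ := (h.and (h1.and h2)).exists
        rwa [h4, h5] at h3
      · intro h
        filter_upwards [h1, h2] with ω h3 h4
        rw [h3, h4]
        exact h
    ext W
    constructor
    · rintro ⟨c, X, hc, hX, rfl⟩
      exact ⟨c, X, hc, (hiff X).1 hX, rfl⟩
    · rintro ⟨c, X, hc, hX, rfl⟩
      exact ⟨c, LInf.ofLp 𝓕 X, hc, (hiff _).2 hX, rfl⟩
  suffices h : ∃ r : Lp ℝ 1 P, IsDensity r ∧ (∀ᵐ ω ∂P, 0 < r ω) ∧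
      ∀ W ∈ Pi.zeroCostCone, pairing P W r ≤ 0 by
    obtain ⟨r, hr, hr_pos, hrC⟩ := h
    refine ⟨r, hr, hr_pos, fun X => ?_⟩
    have h1 : X + Lp.const ∞ P (-Pi.askZero X) ∈ Pi.zeroCostCone := by
      rw [hC]
      exact ⟨1, _, zero_le_one, by rw [hΦ.add_const]; linarith, (one_smul _ _).symm⟩
    have h2 := hrC _ h1
    rw [map_add, LinearMap.add_apply, pairing_const, hr.integral_eq_one] at h2
    linarith
  refine BidAsk.exists_equivalent_density ?_ ?_ ?_ hNFL
  all_goals rw [hC]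
  · rintro _ ⟨c, X, hc, hX, rfl⟩ _ ⟨d, Y, hd, hY, rfl⟩ a b ha hb hab
    -- The combination is rescaled to a convex one by dividing by the total weight; if that weight
    -- is 0, the combination is 0.
    rcases (add_nonneg (mul_nonneg ha hc) (mul_nonneg hb hd)).eq_or_lt with hs | hs
    · have h1 : a * c = 0 := by nlinarith [mul_nonneg ha hc, mul_nonneg hb hd]
      have h2 : b * d = 0 := by nlinarith [mul_nonneg ha hc, mul_nonneg hb hd]
      exact ⟨0, 0, le_rfl, hΦ.zero.le, by rw [smul_smul, smul_smul, h1, h2]; simp⟩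
    · refine ⟨a * c + b * d, (a * c / (a * c + b * d)) • X + (b * d / (a * c + b * d)) • Y,
        hs.le, ?_, ?_⟩
      · have h1 := hΦ.convex.2 (Set.mem_univ X) (Set.mem_univ Y)
          (div_nonneg (mul_nonneg ha hc) hs.le) (div_nonneg (mul_nonneg hb hd) hs.le)
          (by rw [← add_div, div_self hs.ne'])
        refine h1.trans (add_nonpos ?_ ?_)
        · exact mul_nonpos_of_nonneg_of_nonpos (div_nonneg (mul_nonneg ha hc) hs.le) hX
        · exact mul_nonpos_of_nonneg_of_nonpos (div_nonneg (mul_nonneg hb hd) hs.le) hY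
      · rw [smul_add, smul_smul, smul_smul, smul_smul, smul_smul, mul_div_cancel₀ _ hs.ne',
          mul_div_cancel₀ _ hs.ne']
  · rintro _ ⟨c, X, hc, hX, rfl⟩ a ha
    exact ⟨a * c, X, mul_nonneg ha hc, hX, smul_smul _ _ _⟩
  · intro W hW
    exact ⟨1, W, zero_le_one, (hΦ.mono hW).trans_eq hΦ.zero, (one_smul _ _).symm⟩

end TimeZero

/-! ### Martingale measures -/

section Martingale

variable {Ω : Type*} [mΩ : MeasurableSpace Ω] {P : Measure Ω} {𝓕 : Filtration ℝ≥0 mΩ}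

theorem StopTime.sigmaAlg_le (τ : StopTime 𝓕) : τ.sigmaAlg ≤ mΩ := fun _ hs => hs.1

/-- The restriction `1_A W` of `W` to an event `A ∈ F_τ`. -/
noncomputable def LInf.restrict {τ : StopTime 𝓕} {A : Set Ω} (hA : MeasurableSet[τ.sigmaAlg] A)
    (W : LInf P τ) : LInf P τ :=
  ⟨((Lp.memLp (W : Lp ℝ ∞ P)).indicator (τ.sigmaAlg_le A hA)).toLp _, by
    rw [mem_lpMeas_iff_aestronglyMeasurable]
    obtain ⟨f, hf, hWf⟩ := W.2
    refine ⟨A.indicator f, hf.indicator hA, (MemLp.coeFn_toLp _).trans ?_⟩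
    filter_upwards [hWf] with ω h
    by_cases hω : ω ∈ A <;> simp [hω, h]⟩

theorem LInf.coeFn_restrict {τ : StopTime 𝓕} {A : Set Ω} (hA : MeasurableSet[τ.sigmaAlg] A)
    (W : LInf P τ) :
    (LInf.restrict hA W : Lp ℝ ∞ P) =ᵐ[P] A.indicator (W : Lp ℝ ∞ P) :=
  ((Lp.memLp (W : Lp ℝ ∞ P)).indicator (τ.sigmaAlg_le A hA)).coeFn_toLp

/-- The class of the constant `c`, as an element of `L^∞(F_τ)`. -/
noncomputable def LInf.const [IsFiniteMeasure P] (τ : StopTime 𝓕) (c : ℝ) : LInf P τ :=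
  ⟨Lp.const ∞ P c, ⟨fun _ => c, stronglyMeasurable_const,
    Lp.coeFn_const (p := ∞) (μ := P) c⟩⟩

variable {Pi : PricingProcedure P 𝓕}

/-- Locality: a payoff of price at most `0` keeps this property when restricted to an event that is
known at the time of the pricing. -/
theorem PricingProcedure.ask_restrict_nonpos [IsProbabilityMeasure P] {σ τ : StopTime 𝓕}
    (h : σ ≤ τ) {A : Set Ω} (hA : MeasurableSet[σ.sigmaAlg] A) {W : LInf P τ}
    (hW : Pi.ask h W ≤ 0) :
    Pi.ask h (LInf.restrict (StopTime.sigmaAlg_mono h A hA) W) ≤ 0 := by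
  set B : LInf P σ := LInf.const σ ‖(W : Lp ℝ ∞ P)‖ with hB
  set W' := LInf.restrict (StopTime.sigmaAlg_mono h A hA) W with hW'
  have hWB := LInfty.ae_abs_le_norm (W : Lp ℝ ∞ P)
  have hBc : (B : Lp ℝ ∞ P) =ᵐ[P] fun _ => ‖(W : Lp ℝ ∞ P)‖ :=
    Lp.coeFn_const (p := ∞) (μ := P) _
  have hW'c : (W' : Lp ℝ ∞ P) =ᵐ[P] A.indicator (W : Lp ℝ ∞ P) := LInf.coeFn_restrict _ _
  have hc1 := LInf.coeFn_restrict hA B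
  have hc2 := LInf.coeFn_restrict hA.compl B
  -- Two upper bounds on the price, each supported on one side: 1_{Aᶜ} B vanishes on `A`, and 1_A B
  -- vanishes on `Aᶜ`.
  have h1 : Pi.ask h W' ≤ LInf.restrict hA.compl B := by
    have hle : W' ≤ W + LInf.incl h (LInf.restrict hA.compl B) := by
      rw [← Subtype.coe_le_coe, ← Lp.coeFn_le]
      filter_upwards [hWB, hBc, hW'c, hc2,
        Lp.coeFn_add (W : Lp ℝ ∞ P) (LInf.restrict hA.compl B : Lp ℝ ∞ P)] with ω e1 e2 e3 e4 e5
      rw [e3]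
      refine le_of_le_of_eq ?_ e5.symm
      rw [_root_.Pi.add_apply, e4]
      by_cases hω : ω ∈ A
      · simp [hω]
      · simp only [hω, not_false_eq_true, Set.indicator_of_notMem, Set.mem_compl_iff,
          Set.indicator_of_mem, e2]
        linarith [neg_abs_le ((W : Lp ℝ ∞ P) ω)]
    refine (Pi.monotone h _ _ hle).trans ?_
    rw [Pi.translation]
    exact add_le_of_nonpos_left hW
  have h2 : Pi.ask h W' ≤ LInf.restrict hA B := by
    have hle : W' ≤ LInf.incl h (LInf.restrict hA B) := by
      rw [← Subtype.coe_le_coe, ← Lp.coeFn_le]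
      filter_upwards [hWB, hBc, hW'c, hc1] with ω e1 e2 e3 e4
      rw [e3]
      refine le_of_le_of_eq ?_ e4.symm
      by_cases hω : ω ∈ A
      · simp only [hω, Set.indicator_of_mem, e2]
        exact (le_abs_self _).trans e1
      · simp [hω]
    exact (Pi.monotone h _ _ hle).trans_eq (PricingProcedure.ask_incl_self h _)
  rw [← Subtype.coe_le_coe, ← Lp.coeFn_le] at h1 h2 ⊢
  have h0 : ((0 : LInf P σ) : Lp ℝ ∞ P) =ᵐ[P] 0 := Lp.coeFn_zero ℝ ∞ P
  filter_upwards [h1, h2, hc1, hc2, h0] with ω e1 e2 e3 e4 e5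
  rw [e5]
  by_cases hω : ω ∈ A
  · refine e1.trans_eq (e4.trans ?_)
    simp [hω]
  · refine e2.trans_eq (e3.trans ?_)
    simp [hω]

theorem PricingProcedure.askZero_nonpos_of_ask_nonpos [IsProbabilityMeasure P]
    (hF : UsualConditions P 𝓕) (hTC : Pi.TimeConsistent) {σ τ : StopTime 𝓕} (h : σ ≤ τ)
    {W : LInf P τ} (hW : Pi.ask h W ≤ 0) : Pi.askZero (W : Lp ℝ ∞ P) ≤ 0 := by
  have h1 : Pi.ask (StopTime.zero_le τ) W ≤ 0 := by
    rw [← hTC _ σ _ (StopTime.zero_le σ) h, ← Pi.normalized (StopTime.zero_le σ)]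
    exact Pi.monotone _ _ _ hW
  rw [← Subtype.coe_le_coe, ← Lp.coeFn_le] at h1
  have h0 : ((0 : LInf P (StopTime.zero 𝓕)) : Lp ℝ ∞ P) =ᵐ[P] 0 := Lp.coeFn_zero ℝ ∞ P
  obtain ⟨ω, e1, e2, e3⟩ :=
    (h1.and ((PricingProcedure.ask_zero_ae_eq hF hTC W).and h0)).exists
  rwa [e2, e3] at e1

/-- An equivalent probability measure of finite penalty is a local martingale measure. -/
theorem densityMeasure_mem_equivLocalMartingaleMeasures [IsProbabilityMeasure P]
    (hF : UsualConditions P 𝓕) (hPi : Pi.IsTCPP) {ι : Type*} {S : ι → ℝ≥0 → Ω → ℝ}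
    (hS : Pi.ExtendsDynamics S) {q : Lp ℝ 1 P} (hq : IsDensity q) (hq_pos : ∀ᵐ ω ∂P, 0 < q ω)
    {c : ℝ} (hqc : ∀ Y, pairing P Y q - Pi.askZero Y ≤ c) :
    densityMeasure q ∈ EquivLocalMartingaleMeasures P 𝓕 S := by
  have hprob := isProbabilityMeasure_densityMeasure hq
  have hQP := densityMeasure_absolutelyContinuous q
  refine ⟨hprob, hQP, absolutelyContinuous_densityMeasure hq_pos, fun k σ τ h hτ V hV => ?_⟩
  have hU : (Pi.ask h V : Lp ℝ ∞ P) =ᵐ[P] stoppedValue (S k) σ.1 := by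
    have := hS k 1 σ τ h hτ V hV
    simpa using this
  set U := Pi.ask h V with hUdef
  have hint : ∀ Z : Lp ℝ ∞ P, Integrable Z (densityMeasure q) := fun Z =>
    (memLp_top_of_bound ((Lp.aestronglyMeasurable Z).mono_ac hQP) ‖Z‖
      (hQP.ae_le (LInfty.ae_abs_le_norm Z))).integrable le_top
  have hle : ∀ (n : ℤ) (A : Set Ω) (hA : MeasurableSet[σ.sigmaAlg] A),
      (n : ℝ) * (∫ ω in A, (V : Lp ℝ ∞ P) ω ∂densityMeasure q -
        ∫ ω in A, (U : Lp ℝ ∞ P) ω ∂densityMeasure q) ≤ c := by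
    intro n A hA
    -- Exact pricing of all integer multiples, negative ones included, is what allows `n` to be sent
    -- to both infinities against the fixed bound `c`.
    have hnU : Pi.ask h ((n : ℝ) • V) = (n : ℝ) • U := by
      refine Subtype.ext (Lp.ext ?_)
      filter_upwards [hS k n σ τ h hτ V hV, hU, Lp.coeFn_smul (n : ℝ) (U : Lp ℝ ∞ P)]
        with ω e1 e2 e3
      refine e1.trans (Eq.trans ?_ e3.symm)
      simp [e2]
    set W : LInf P τ := (n : ℝ) • V + LInf.incl h (-((n : ℝ) • U)) with hW
    have hW0 : Pi.ask h W ≤ 0 := by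
      rw [hW, Pi.translation, hnU, add_neg_cancel]
    have h1 := PricingProcedure.askZero_nonpos_of_ask_nonpos hF hPi.timeConsistent h
      (PricingProcedure.ask_restrict_nonpos h hA hW0)
    have h2 := hqc (LInf.restrict (StopTime.sigmaAlg_mono h A hA) W : Lp ℝ ∞ P)
    refine le_trans (le_of_eq ?_) ((le_sub_self_iff _).2 h1 |>.trans h2)
    rw [← integral_densityMeasure_eq_pairing hq,
      integral_congr_ae (hQP.ae_le (LInf.coeFn_restrict (StopTime.sigmaAlg_mono h A hA) W)),
      integral_indicator (σ.sigmaAlg_le A hA),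
      ← integral_sub (hint _).integrableOn (hint _).integrableOn, ← integral_const_mul]
    refine integral_congr_ae (ae_restrict_of_ae (hQP.ae_le ?_))
    filter_upwards [Lp.coeFn_add ((n : ℝ) • (V : Lp ℝ ∞ P)) (-((n : ℝ) • (U : Lp ℝ ∞ P))),
      Lp.coeFn_neg ((n : ℝ) • (U : Lp ℝ ∞ P)), Lp.coeFn_smul (n : ℝ) (U : Lp ℝ ∞ P),
      Lp.coeFn_smul (n : ℝ) (V : Lp ℝ ∞ P)] with ω e1 e2 e3 e4
    refine Eq.trans ?_ e1.symm
    rw [_root_.Pi.add_apply, e2, _root_.Pi.neg_apply, e3, e4]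
    simp only [_root_.Pi.smul_apply, smul_eq_mul]
    ring
  have heq : ∀ A : Set Ω, MeasurableSet[σ.sigmaAlg] A →
      ∫ ω in A, (U : Lp ℝ ∞ P) ω ∂densityMeasure q =
        ∫ ω in A, (V : Lp ℝ ∞ P) ω ∂densityMeasure q := by
    intro A hA
    set D := ∫ ω in A, (V : Lp ℝ ∞ P) ω ∂densityMeasure q -
      ∫ ω in A, (U : Lp ℝ ∞ P) ω ∂densityMeasure q with hD
    suffices D = 0 by linarith
    by_contra hne
    obtain ⟨n, hn⟩ := exists_nat_gt (c / |D|)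
    rw [div_lt_iff₀ (abs_pos.2 hne)] at hn
    rcases abs_choice D with hd | hd <;> rw [hd] at hn
    · have := hle n A hA
      push_cast at this
      linarith
    · have := hle (-n) A hA
      push_cast at this
      linarith
  refine EventuallyEq.trans ?_ (hQP.ae_le hU)
  refine (ae_eq_condExp_of_forall_setIntegral_eq σ.sigmaAlg_le (hint _)
    (fun A _ _ => (hint _).integrableOn) (fun A hA _ => heq A hA) ?_).symm
  obtain ⟨f, hf, hUf⟩ := U.2
  exact ⟨f, hf, hQP.ae_le hUf⟩

/-- The penalty bound at Y^l and -Y^l, combined with Φ(Y^l) ≤ C_ask and C_bid ≤ -Φ(-Y^l), bounds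
both deviations by `c`; the bound at 0 gives c ≥ 0, which also covers an empty family of options. -/
theorem beta_densityMeasure_le [IsProbabilityMeasure P] (hF : UsualConditions P 𝓕)
    (hPi : Pi.IsTCPP) {p : ℕ} {T : Fin p → StopTime 𝓕} {Y : ∀ l, LInf P (T l)}
    {Cbid Cask : Fin p → ℝ} {ι : Type*} {S : ι → ℝ≥0 → Ω → ℝ}
    (hSA : Pi.StronglyAdmissible S T Y Cbid Cask) {q : Lp ℝ 1 P} (hq : IsDensity q) {c : ℝ}
    (hqc : ∀ Z, pairing P Z q - Pi.askZero Z ≤ c) :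
    beta Y Cbid Cask (densityMeasure q) ≤ c := by
  have hc : 0 ≤ c := by
    have := hqc 0
    rw [(PricingProcedure.isMonetary_askZero hF hPi).zero] at this
    simpa using this
  refine max_le hc (Real.iSup_le (fun l => ?_) hc)
  rw [integral_densityMeasure_eq_pairing hq]
  have hneg : (Pi.bid (StopTime.zero_le (T l)) (Y l) : Lp ℝ ∞ P) =ᵐ[P]
      fun _ => -Pi.askZero (-(Y l : Lp ℝ ∞ P)) := by
    filter_upwards [Lp.coeFn_neg (Pi.ask (StopTime.zero_le (T l)) (-Y l) : Lp ℝ ∞ P),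
      PricingProcedure.ask_zero_ae_eq hF hPi.timeConsistent (-Y l)] with ω e1 e2
    exact e1.trans (congrArg Neg.neg e2)
  obtain ⟨ω, ⟨e1, -, e2⟩, e3, e4⟩ := ((hSA.compatible l).and (hneg.and
    (PricingProcedure.ask_zero_ae_eq hF hPi.timeConsistent (Y l)))).exists
  rw [e3] at e1
  rw [e4] at e2
  have h1 := hqc (Y l)
  have h2 := hqc (-(Y l : Lp ℝ ∞ P))
  rw [map_neg, LinearMap.neg_apply] at h2
  exact max_le (by linarith) (by linarith)

/-- Every number below the price at time `0` is exceeded by a penalized expectation. -/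
theorem exists_lt_integral_sub_beta [IsProbabilityMeasure P] (hF : UsualConditions P 𝓕) (hPi : Pi.IsTCPP)
    (hNFL : Pi.NoFreeLunch) {p : ℕ} {T : Fin p → StopTime 𝓕} {Y : ∀ l, LInf P (T l)}
    {Cbid Cask : Fin p → ℝ} {ι : Type*} {S : ι → ℝ≥0 → Ω → ℝ}
    (hSA : Pi.StronglyAdmissible S T Y Cbid Cask) (X : Lp ℝ ∞ P) {t : ℝ} (ht : t < Pi.askZero X) :
    ∃ Q ∈ EquivLocalMartingaleMeasures P 𝓕 S,
      t < ∫ ω, X ω ∂Q - beta Y Cbid Cask Q := by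
  obtain ⟨r, hr, hr_pos, hrX⟩ :=
    PricingProcedure.exists_equivalent_density_le_askZero hF hPi hNFL
  obtain ⟨q, c, hq, hq_pos, hqc, hlt⟩ :=
    (PricingProcedure.isMonetary_askZero hF hPi).exists_equivalent_density hr hr_pos hrX X ht
  refine ⟨densityMeasure q, densityMeasure_mem_equivLocalMartingaleMeasures hF hPi
    hSA.extendsDynamics hq hq_pos hqc, hlt.trans_le ?_⟩
  rw [integral_densityMeasure_eq_pairing hq]
  have := beta_densityMeasure_le hF hPi hSA hq hqc
  linarith

end Martingale

end BidAsk

theorem mainTheorem12 {Ω : Type*} [mΩ : MeasurableSpace Ω]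
    (P : MeasureTheory.Measure Ω) [MeasureTheory.IsProbabilityMeasure P]
    (𝓕 : MeasureTheory.Filtration ℝ≥0 mΩ) (hF : BidAsk.UsualConditions P 𝓕)
    (d p : ℕ) (S : Fin (d + 1) → ℝ≥0 → Ω → ℝ)
    (hS_adapted : ∀ k, MeasureTheory.Adapted 𝓕 (S k))
    (hS_numeraire : ∀ t ω, S 0 t ω = 1)
    (hS_locBdd : ∀ k, BidAsk.LocallyBounded P 𝓕 (S k))
    (T : Fin p → BidAsk.StopTime 𝓕) (Y : ∀ l, BidAsk.LInf P (T l)) (Cbid Cask : Fin p → ℝ)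
    (Pi : BidAsk.PricingProcedure P 𝓕) (hTCPP : Pi.IsTCPP) (hNFL : Pi.NoFreeLunch)
    (hSA : Pi.StronglyAdmissible S T Y Cbid Cask)
    (X : BidAsk.LInf P (BidAsk.StopTime.infty 𝓕)) :
    ∀ᵐ ω ∂P,
      (⨅ Q ∈ BidAsk.EquivLocalMartingaleMeasures P 𝓕 S,
          (((∫ ω', (X : Lp ℝ ∞ P) ω' ∂Q) + BidAsk.beta Y Cbid Cask Q : ℝ) : EReal)) ≤
        (((Pi.bid (BidAsk.StopTime.zero_le _) X : Lp ℝ ∞ P) ω : ℝ) : EReal) ∧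
      (Pi.bid (BidAsk.StopTime.zero_le _) X : Lp ℝ ∞ P) ω ≤
        (Pi.ask (BidAsk.StopTime.zero_le _) X : Lp ℝ ∞ P) ω ∧
      (((Pi.ask (BidAsk.StopTime.zero_le _) X : Lp ℝ ∞ P) ω : ℝ) : EReal) ≤
        ⨆ Q ∈ BidAsk.EquivLocalMartingaleMeasures P 𝓕 S,
          (((∫ ω', (X : Lp ℝ ∞ P) ω' ∂Q) - BidAsk.beta Y Cbid Cask Q : ℝ) : EReal) := by
  have hΦ := BidAsk.PricingProcedure.isMonetary_askZero hF hTCPP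
  filter_upwards [BidAsk.PricingProcedure.ask_zero_ae_eq hF hTCPP.timeConsistent X,
    BidAsk.PricingProcedure.ask_zero_ae_eq hF hTCPP.timeConsistent (-X),
    Lp.coeFn_neg (Pi.ask (BidAsk.StopTime.zero_le _) (-X) : Lp ℝ ∞ P)] with ω e1 e2 e3
  have hbid : (Pi.bid (BidAsk.StopTime.zero_le _) X : Lp ℝ ∞ P) ω =
      -Pi.askZero (-(X : Lp ℝ ∞ P)) := e3.trans (congrArg Neg.neg e2)
  rw [hbid, e1]
  refine ⟨EReal.le_of_forall_lt_iff_le.1 fun t ht => ?_, ?_,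
    EReal.ge_of_forall_gt_iff_ge.1 fun t ht => ?_⟩
  · obtain ⟨Q, hQ, hlt⟩ := BidAsk.exists_lt_integral_sub_beta hF hTCPP hNFL hSA (-(X : Lp ℝ ∞ P))
      (show -t < _ by have := EReal.coe_lt_coe_iff.1 ht; linarith)
    refine (iInf₂_le Q hQ).trans (EReal.coe_le_coe_iff.2 ?_)
    rw [integral_congr_ae (hQ.2.1.ae_le (Lp.coeFn_neg (X : Lp ℝ ∞ P)))] at hlt
    simp only [_root_.Pi.neg_apply, integral_neg] at hlt
    linarith
  -- Midpoint convexity between X and -X gives 0 = Φ(0) ≤ (Φ(X) + Φ(-X)) / 2.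
  · have h := hΦ.convex.2 (Set.mem_univ (X : Lp ℝ ∞ P)) (Set.mem_univ (-(X : Lp ℝ ∞ P)))
      (show (0 : ℝ) ≤ 1 / 2 by norm_num) (show (0 : ℝ) ≤ 1 / 2 by norm_num) (by norm_num)
    rw [smul_neg, add_neg_cancel, hΦ.zero, smul_eq_mul, smul_eq_mul] at h
    linarith
  · obtain ⟨Q, hQ, hlt⟩ := BidAsk.exists_lt_integral_sub_beta hF hTCPP hNFL hSA (X : Lp ℝ ∞ P)
      (EReal.coe_lt_coe_iff.1 ht)
    exact (EReal.coe_le_coe_iff.2 hlt.le).trans (le_iSup₂ (f := fun Q _ =>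
      (((∫ ω', (X : Lp ℝ ∞ P) ω' ∂Q) - BidAsk.beta Y Cbid Cask Q : ℝ) : EReal)) Q hQ)
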